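/- Let $d\ge 1$ and let $X=(X_1,\dots,X_d)$ be a random vector with continuous univariate marginal distribution functions $F_1,\dots,F_d$. Put $U_j=F_j(X_j)$, so that the copula $C$ of $X$ is the distribution function of $U=(U_1,\dots,U_d)$; let $C_{ij}$ be the distribution function of $(U_i,U_j)$ and $\bar C_{ij}(u,v)=\Pr(U_i>u,U_j>v)$. A partition $\mathcal H$ of $\{1,\dots,d\}$ satisfies the *partial exchangeability assumption* (PEA) if $(U_{\pi(1)},\dots,U_{\pi(d)})$ has the same law as $U$ for every permutation $\pi$ that maps each cluster of $\mathcal H$ onto itself. Let $\mathcal G$ be the coarsest PEA partition, i.e. a PEA partition with the smallest number of clusters. Let $p=d(d-1)/2$ and index the coordinates of $\mathbb R^p$ by the pairs $r=(i_r,j_r)$ with $1\le i_r<j_r\le d$. For a partition $\mathcal H$, two such pairs are in the same block if the unordered pairs of clusters containing their two indices agree; let $\mathcal B_1,\dots,\mathcal B_L$ be the blocks, $B_{\mathcal H}\in\{0,1\}^{p\times L}$ the block membership matrix, $(B_{\mathcal H})_{r\ell}=\mathbf 1(r\in\mathcal B_\ell)$, and $\Gamma_{\mathcal H}=B_{\mathcal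 H}B_{\mathcal H}^+$, where $^+$ is the Moore--Penrose inverse. Let $\tau\in\mathbb R^p$ be the vector of Kendall correlations, $\tau_r=\Pr\{(X_{i_r}-X^*_{i_r})(X_{j_r}-X^*_{j_r})>0\}-\Pr\{(X_{i_r}-X^*_{i_r})(X_{j_r}-X^*_{j_r})<0\}$ with $X^*$ an independent copy of $X$, and let $\Sigma_\infty\in\mathbb R^{p\times p}$ be the asymptotic covariance matrix of the empirical Kendall correlations, $$(\Sigma_\infty)_{rs}=16(\theta_1+\theta_2+\theta_3+\theta_4)-4(\tau_r+1)(\tau_s+1),$$ where, with $C_r=C_{i_rj_r}(U_{i_r},U_{j_r})$ and $\bar C_r=\bar C_{i_rj_r}(U_{i_r},U_{j_r})$, $\theta_1=E(C_rC_s)$, $\theta_2=E(\bar C_rC_s)$, $\theta_3=E(C_r\bar C_s)$, $\theta_4=E(\bar C_r\bar C_s)$. **Estimators.** Let $X_1,\dots,X_n$ be a random sample from $X$, with $X_a=(X_{a1},\dots,X_{ad})$. Put $$\hat\tau_r=-1+\frac4{n(n-1)}\sum_{a\ne b}\mathbf 1(X_{ai_r}\le X_{bi_r})\,\mathbf 1(X_{aj_r}\le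 X_{bj_r}),\qquad \tilde\tau(\mathcal H)=\Gamma_{\mathcal H}\hat\tau,\qquad I^{(r)}_{ab}=\mathbf 1(X_{ai_r}<X_{bi_r},\,X_{aj_r}<X_{bj_r}),$$ $$\hat\Theta_{rs}=\Bigl\{\frac4{n(n-1)}\Bigr\}^2\Bigl[\sum_{a,b,c\ \mathrm{distinct}}I^{(r)}_{ab}\bigl(I^{(s)}_{cb}+I^{(s)}_{ca}+I^{(s)}_{bc}+I^{(s)}_{ac}\bigr)+\sum_{a\neq b}I^{(r)}_{ab}\bigl(I^{(s)}_{ab}+I^{(s)}_{ba}\bigr)\Bigr].$$ Let $\tilde\Theta(\mathcal H)$ be the symmetric matrix obtained by averaging the entries $(r,s)$, $r\le s$, of $\hat\Theta$ over the classes of entries with the same unordered pair of blocks (of $r$ and of $s$) and the same multiset of clusters of the indices in $\{i_r,j_r\}\cap\{i_s,j_s\}$. With $\mathbf 1$ the vector of ones and $w\in[0,1]$ the shrinkage weight, put $$\tilde\Sigma(\mathcal H)=\tilde\Theta(\mathcal H)-\frac{2(2n-3)}{n(n-1)}\,(\tilde\tau(\mathcal H)+\mathbf 1)(\tilde\tau(\mathcal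 H)+\mathbf 1)^\top,\qquad \tilde\Sigma_w(\mathcal H)=(1-w)\tilde\Sigma(\mathcal H)+w\,\mathrm{diag}\,\tilde\Sigma(\mathcal H).$$ **Algorithm.** Start from $\mathcal G^{(d)}=\{\{1\},\dots,\{d\}\}$. For $i=d-1,\dots,1$ let $\mathcal G^{(i)}$ be a minimizer of $$(\hat\tau-\tilde\tau(\mathcal H))^\top\,\tilde\Sigma_w(\mathcal G^{(i+1)})^{-1}\,(\hat\tau-\tilde\tau(\mathcal H))$$ over the partitions $\mathcal H$ with $i$ clusters obtained by merging two clusters of $\mathcal G^{(i+1)}$; ties are broken arbitrarily, and any merger is allowed if the matrix is singular. Return the path $\mathcal P=\{\mathcal G^{(d)},\dots,\mathcal G^{(1)}\}$. **Statement.** Assume that $\Sigma_\infty$ is positive definite, that for every partition $\mathcal H$ of $\{1,\dots,d\}$ one has $\Gamma_{\mathcal H}\tau=\tau$ if and only if $\mathcal H$ satisfies the PEA, and that the weights $w=w_n\in[0,1]$ satisfy $w_n\to0$ as $n\to\infty$. Then the path $\mathcal P$ returned by the algorithm satisfies $\Pr(\mathcal G\in\mathcal P)\to1$ as $n\to\infty$.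 -/

import Mathlib

open MeasureTheory ProbabilityTheory Filter Topology

namespace KendallPath

noncomputable section

/-! ### Partitions of the index set and the blocks they induce -/

/-- Partitions of the set of the `d` variable indices into nonempty clusters.  In Mathlib's order,
`G ≤ H` means that every cluster of `G` is contained in a cluster of `H`. -/
abbrev IdxPartition (d : ℕ) : Type := Finpartition (Finset.univ : Finset (Fin d))

/-- The `p = d (d - 1) / 2` positions above the main diagonal of a `d × d` matrix; they index the
vectorization of a symmetric matrix. -/
abbrev Pos (d : ℕ) : Type := {q : Fin d × Fin d // q.1 < q.2}

variable {d : ℕ}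

/-- The unordered pair of clusters of `G` that contain the two indices of the position `r`.  The
blocks of positions induced by `G` are the nonempty fibres of this map. -/
def block (G : IdxPartition d) (r : Pos d) : Sym2 (Finset (Fin d)) :=
  s(G.part r.1.1, G.part r.1.2)

/-- The (nonempty) blocks of positions induced by `G`. -/
abbrev Block (G : IdxPartition d) : Type :=
  {b : Sym2 (Finset (Fin d)) // b ∈ Finset.univ.image (block G)}

/-- The number of positions in a block. -/
def blockSize (G : IdxPartition d) (b : Block G) : ℕ :=
  (Finset.univ.filter fun r : Pos d => block G r = b.1).card

/-- The `p × L` block membership matrix of `G`. -/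
def blockMatrix (G : IdxPartition d) : Matrix (Pos d) (Block G) ℝ :=
  Matrix.of fun r b => if block G r = b.1 then 1 else 0

/-- The Moore--Penrose inverse of the block membership matrix (see `blockMatrix_moorePenrose`). -/
def blockPinv (G : IdxPartition d) : Matrix (Block G) (Pos d) ℝ :=
  Matrix.of fun b r => if block G r = b.1 then (blockSize G b : ℝ)⁻¹ else 0

/-- `Y` satisfies the four Penrose equations for `A`. -/
structure IsMoorePenrose {m n : Type*} [Fintype m] [Fintype n]
    (A : Matrix m n ℝ) (Y : Matrix n m ℝ) : Prop where
  left : A * Y * A = A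
  right : Y * A * Y = Y
  symm_left : (A * Y).transpose = A * Y
  symm_right : (Y * A).transpose = Y * A

theorem blockSize_pos (G : IdxPartition d) (b : Block G) : 0 < blockSize G b := by
  obtain ⟨b, hb⟩ := b
  obtain ⟨r, -, hr⟩ := Finset.mem_image.1 hb
  exact Finset.card_pos.2 ⟨r, by simp [hr]⟩

theorem blockPinv_mul_blockMatrix (G : IdxPartition d) : blockPinv G * blockMatrix G = 1 := by
  ext b c
  have hb : (blockSize G b : ℝ) ≠ 0 := by exact_mod_cast (blockSize_pos G b).ne'
  rw [Matrix.mul_apply]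
  by_cases h : b = c
  · subst h
    have : ∀ r : Pos d, blockPinv G b r * blockMatrix G r b
        = if block G r = b.1 then (blockSize G b : ℝ)⁻¹ else 0 := by
      intro r
      by_cases hr : block G r = b.1 <;> simp [blockPinv, blockMatrix, hr]
    simp only [this, Matrix.one_apply_eq, ← Finset.sum_filter, Finset.sum_const, nsmul_eq_mul]
    exact mul_inv_cancel₀ hb
  · rw [Matrix.one_apply_ne h]
    refine Finset.sum_eq_zero fun r _ => ?_
    by_cases hr : block G r = b.1
    · have : block G r ≠ c.1 := fun hc => h (Subtype.ext (hr.symm.trans hc))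
      simp [blockMatrix, this]
    · simp [blockPinv, hr]

theorem blockMatrix_moorePenrose (G : IdxPartition d) :
    IsMoorePenrose (blockMatrix G) (blockPinv G) where
  left := by rw [Matrix.mul_assoc, blockPinv_mul_blockMatrix, Matrix.mul_one]
  right := by rw [blockPinv_mul_blockMatrix, Matrix.one_mul]
  symm_right := by rw [blockPinv_mul_blockMatrix, Matrix.transpose_one]
  symm_left := by
    ext r s
    rw [Matrix.transpose_apply, Matrix.mul_apply, Matrix.mul_apply]
    refine Finset.sum_congr rfl fun b _ => ?_
    by_cases hr : block G r = b.1 <;> by_cases hs : block G s = b.1 <;>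
      simp [blockMatrix, blockPinv, hr, hs]

/-- The matrix `Γ = B B⁺`. -/
def Gam (G : IdxPartition d) : Matrix (Pos d) (Pos d) ℝ := blockMatrix G * blockPinv G

/-! ### The population: copula, partial exchangeability, Kendall's tau -/

/-- The distribution function `F_j` of the `j`-th marginal of `ν`. -/
def margCdf (ν : Measure (Fin d → ℝ)) (j : Fin d) : ℝ → ℝ := cdf (ν.map fun y => y j)

/-- The law of `(F_1(X_1), …, F_d(X_d))` for `X ∼ ν`; for continuous marginals, its distribution
function is the copula of `ν`. -/
def copulaLaw (ν : Measure (Fin d → ℝ)) : Measure (Fin d → ℝ) :=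
  ν.map fun y j => margCdf ν j (y j)

/-- The partial exchangeability assumption: the law of `(U_1, …, U_d)` is invariant under all
permutations of the coordinates that preserve every cluster. -/
def PEA (ν : Measure (Fin d → ℝ)) (G : IdxPartition d) : Prop :=
  ∀ π : Equiv.Perm (Fin d), (∀ j, ∀ A ∈ G.parts, j ∈ A ↔ π j ∈ A) →
    (copulaLaw ν).map (fun u j => u (π j)) = copulaLaw ν

/-- `G` is a partition with the smallest number of clusters among those that satisfy the partial
exchangeability assumption. -/
def IsCoarsestPEA (ν : Measure (Fin d → ℝ)) (G : IdxPartition d) : Prop :=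
  PEA ν G ∧ ∀ H : IdxPartition d, PEA ν H → G.parts.card ≤ H.parts.card

/-- The vector `τ` of the pairwise Kendall correlations: probability of concordance minus
probability of discordance of two independent copies. -/
def tau (ν : Measure (Fin d → ℝ)) (r : Pos d) : ℝ :=
  (ν.prod ν).real {z | 0 < (z.1 r.1.1 - z.2 r.1.1) * (z.1 r.1.2 - z.2 r.1.2)}
    - (ν.prod ν).real {z | (z.1 r.1.1 - z.2 r.1.1) * (z.1 r.1.2 - z.2 r.1.2) < 0}

/-- The bivariate copula `C_{ij}`, `(i, j) = r`, evaluated at `(u_i, u_j)`. -/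
def copC (ν : Measure (Fin d → ℝ)) (r : Pos d) (u : Fin d → ℝ) : ℝ :=
  (copulaLaw ν).real {v | v r.1.1 ≤ u r.1.1 ∧ v r.1.2 ≤ u r.1.2}

/-- The survival function of the copula `C_{ij}`, `(i, j) = r`, evaluated at `(u_i, u_j)`. -/
def copS (ν : Measure (Fin d → ℝ)) (r : Pos d) (u : Fin d → ℝ) : ℝ :=
  (copulaLaw ν).real {v | u r.1.1 < v r.1.1 ∧ u r.1.2 < v r.1.2}

/-- The sum `θ₁ + θ₂ + θ₃ + θ₄`. -/
def thetaSum (ν : Measure (Fin d → ℝ)) (r s : Pos d) : ℝ :=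
  (∫ u, copC ν r u * copC ν s u ∂(copulaLaw ν)) + (∫ u, copS ν r u * copC ν s u ∂(copulaLaw ν))
    + (∫ u, copC ν r u * copS ν s u ∂(copulaLaw ν)) + ∫ u, copS ν r u * copS ν s u ∂(copulaLaw ν)

/-- The asymptotic covariance matrix `Σ_∞` of `√n (τ̂ - τ)`. -/
def SigmaInf (ν : Measure (Fin d → ℝ)) : Matrix (Pos d) (Pos d) ℝ :=
  Matrix.of fun r s => 16 * thetaSum ν r s - 4 * (tau ν r + 1) * (tau ν s + 1)

/-! ### The estimators, computed from a data set `x` of `n` observations -/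

variable {n : ℕ}

/-- The vector `τ̂` of the empirical Kendall correlations. -/
def tauHat (x : Fin n → Fin d → ℝ) (r : Pos d) : ℝ :=
  -1 + 4 / ((n : ℝ) * (n - 1)) *
    ∑ a : Fin n, ∑ b : Fin n,
      if a ≠ b ∧ x a r.1.1 ≤ x b r.1.1 ∧ x a r.1.2 ≤ x b r.1.2 then 1 else 0

/-- The vector `τ̃(τ̂ | G) = Γ τ̂`. -/
def tauTilde (x : Fin n → Fin d → ℝ) (G : IdxPartition d) : Pos d → ℝ :=
  (Gam G).mulVec (tauHat x)

/-- The indicator that observation `a` lies strictly below observation `b` in both coordinates of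
the position `r`. -/
def below (x : Fin n → Fin d → ℝ) (r : Pos d) (a b : Fin n) : ℝ :=
  if x a r.1.1 < x b r.1.1 ∧ x a r.1.2 < x b r.1.2 then 1 else 0

/-- The sum `θ̂₁ + θ̂₂ + θ̂₃ + θ̂₄`; the inner sums run over triples of distinct observations. -/
def thetaSumHat (x : Fin n → Fin d → ℝ) (r s : Pos d) : ℝ :=
  1 / ((n : ℝ) * (n - 1) * (n - 2)) *
    ∑ a : Fin n, ∑ b : Fin n, ∑ c : Fin n,
      if a ≠ b ∧ b ≠ c ∧ a ≠ c then
        below x r a b * below x s c b + below x r a b * below x s c a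
          + below x r a b * below x s b c + below x r a b * below x s a c
      else 0

/-- The sum `ϑ̂₁ + ϑ̂₂`. -/
def varthetaSumHat (x : Fin n → Fin d → ℝ) (r s : Pos d) : ℝ :=
  1 / ((n : ℝ) * (n - 1)) *
    ∑ a : Fin n, ∑ b : Fin n,
      if a ≠ b then below x r a b * below x s a b + below x r a b * below x s b a else 0

/-- The plug-in estimator `Θ̂`. -/
def ThetaHat (x : Fin n → Fin d → ℝ) : Matrix (Pos d) (Pos d) ℝ :=
  Matrix.of fun r s => (4 / ((n : ℝ) * (n - 1))) ^ 2 *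
    ((n : ℝ) * (n - 1) * (n - 2) * thetaSumHat x r s + (n : ℝ) * (n - 1) * varthetaSumHat x r s)

/-- The unordered pair of the blocks of `r` and `s`. -/
def blockPair (G : IdxPartition d) (r s : Pos d) : Sym2 (Sym2 (Finset (Fin d))) :=
  s(block G r, block G s)

/-- The multiset of the clusters (zero, one or two of them) of the indices shared by the positions
`r` and `s`. -/
def overlap (G : IdxPartition d) (r s : Pos d) : Multiset (Finset (Fin d)) :=
  (({r.1.1, r.1.2} : Finset (Fin d)) ∩ {s.1.1, s.1.2}).val.map G.part

/-- The class of the entry `(r, s)` of a `p × p` matrix: the entries on or above the diagonal (for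
the lexicographic order of positions) with the same pair of blocks and the same overlap. -/
def entryClass (G : IdxPartition d) (r s : Pos d) : Finset (Pos d × Pos d) :=
  Finset.univ.filter fun q => toLex q.1.1 ≤ toLex q.2.1 ∧
    blockPair G q.1 q.2 = blockPair G r s ∧ overlap G q.1 q.2 = overlap G r s

/-- The estimator `Θ̃`: the entries of `Θ̂` are averaged over each class.  Both labels of a class
are symmetric in `(r, s)`, so that `Θ̃` is symmetric. -/
def ThetaTilde (x : Fin n → Fin d → ℝ) (G : IdxPartition d) : Matrix (Pos d) (Pos d) ℝ :=
  Matrix.of fun r s =>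
    (∑ q ∈ entryClass G r s, ThetaHat x q.1 q.2) / ((entryClass G r s).card : ℝ)

/-- The estimator `Σ̃` of the covariance matrix of `τ̂` under the structure `G`. -/
def SigmaTilde (x : Fin n → Fin d → ℝ) (G : IdxPartition d) : Matrix (Pos d) (Pos d) ℝ :=
  ThetaTilde x G - (2 * (2 * (n : ℝ) - 3) / ((n : ℝ) * (n - 1))) •
    Matrix.of fun r s => (tauTilde x G r + 1) * (tauTilde x G s + 1)

/-- The estimator `Σ̃_w` with shrinkage intensity `w`. -/
def SigmaTildeW (x : Fin n → Fin d → ℝ) (w : ℝ) (G : IdxPartition d) : Matrix (Pos d) (Pos d) ℝ :=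
  (1 - w) • SigmaTilde x G + w • Matrix.diagonal fun r => SigmaTilde x G r r

/-- The loss `(τ̂ - t)ᵀ S⁻¹ (τ̂ - t)`. -/
def loss (t tauhat : Pos d → ℝ) (S : Matrix (Pos d) (Pos d) ℝ) : ℝ :=
  dotProduct (tauhat - t) (S⁻¹.mulVec (tauhat - t))

/-! ### The agglomerative algorithm -/

/-- The partitions into `i` clusters that are obtained from `G` by merging clusters. -/
def candidates (G : IdxPartition d) (i : ℕ) : Set (IdxPartition d) := {H | G ≤ H ∧ H.parts.card = i}

/-- The criterion by which the algorithm compares the candidates `H` when the current partition is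
`G`.  If the current covariance estimate is singular, its Mathlib inverse is `0` and the criterion
vanishes identically, so that no candidate is excluded in that case. -/
def criterion (x : Fin n → Fin d → ℝ) (w : ℝ) (G H : IdxPartition d) : ℝ :=
  loss (tauTilde x H) (tauHat x) (SigmaTildeW x w G)

/-- `P` is a path returned by the algorithm for the data `x` and the weight `w`: it consists of
partitions `g d, …, g 1`, where `g d` is the partition into singletons and, for `i = d - 1, …, 1`,
`g i` minimizes the criterion among the candidates with `i` clusters (ties are broken in any way). -/
def IsReturnedPath (x : Fin n → Fin d → ℝ) (w : ℝ) (P : Set (IdxPartition d)) : Prop :=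
  ∃ g : ℕ → IdxPartition d, g d = ⊥ ∧
    (∀ i, 1 ≤ i → i < d → g i ∈ candidates (g (i + 1)) i ∧
      ∀ H ∈ candidates (g (i + 1)) i,
        criterion x w (g (i + 1)) (g i) ≤ criterion x w (g (i + 1)) H) ∧
    P = g '' Set.Icc 1 d

theorem candidates_nonempty (G : IdxPartition d) {i : ℕ} (hi : 1 ≤ i) (hG : G.parts.card = i + 1) :
    (candidates G i).Nonempty := by
  obtain ⟨A, hA, B, hB, hAB⟩ := Finset.one_lt_card.1 (by omega : 1 < G.parts.card)
  have hnot : A ∪ B ∉ (G.parts.erase A).erase B := by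
    intro h
    have h1 : A ∪ B ∈ G.parts := Finset.mem_of_mem_erase (Finset.mem_of_mem_erase h)
    obtain ⟨a, ha⟩ := G.nonempty_of_mem_parts hA
    have : A ∪ B = A := G.eq_of_mem_parts h1 hA (Finset.mem_union_left _ ha) ha
    have h2 := (Finset.mem_erase.1 (Finset.mem_of_mem_erase h)).1
    exact h2 this
  let Q : IdxPartition d := Finpartition.ofExistsUnique
    (insert (A ∪ B) ((G.parts.erase A).erase B)) (fun p _ => Finset.subset_univ p)
    (by
      intro a _
      by_cases ha : a ∈ A ∪ B
      · refine ⟨A ∪ B, ⟨by simp, ha⟩, ?_⟩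
        rintro C ⟨hC, haC⟩
        rcases Finset.mem_insert.1 hC with h | h
        · exact h
        · obtain ⟨hCB, hC2⟩ := Finset.mem_erase.1 h
          obtain ⟨hCA, hC3⟩ := Finset.mem_erase.1 hC2
          rcases Finset.mem_union.1 ha with h' | h'
          · exact absurd (G.eq_of_mem_parts hC3 hA haC h') hCA
          · exact absurd (G.eq_of_mem_parts hC3 hB haC h') hCB
      · have haA : a ∉ A := fun h => ha (Finset.mem_union_left _ h)
        have haB : a ∉ B := fun h => ha (Finset.mem_union_right _ h)
        obtain ⟨C, hC, haC⟩ := G.exists_mem (Finset.mem_univ a)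
        have hCA : C ≠ A := by rintro rfl; exact haA haC
        have hCB : C ≠ B := by rintro rfl; exact haB haC
        refine ⟨C, ⟨by simp [hC, hCA, hCB], haC⟩, ?_⟩
        rintro D ⟨hD, haD⟩
        rcases Finset.mem_insert.1 hD with h | h
        · subst h; exact absurd haD ha
        · exact G.eq_of_mem_parts (Finset.mem_of_mem_erase (Finset.mem_of_mem_erase h)) hC haD haC)
    (by
      intro h
      rcases Finset.mem_insert.1 h with h | h
      · obtain ⟨a, ha⟩ := G.nonempty_of_mem_parts hA
        have : a ∈ (∅ : Finset (Fin d)) := h ▸ Finset.mem_union_left _ ha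
        simp at this
      · exact G.empty_notMem_parts (Finset.mem_of_mem_erase (Finset.mem_of_mem_erase h)))
  have hQ : Q.parts = insert (A ∪ B) ((G.parts.erase A).erase B) := rfl
  refine ⟨Q, ?_, ?_⟩
  · intro C hC
    by_cases hCA : C = A
    · exact ⟨A ∪ B, by simp [hQ], hCA ▸ Finset.subset_union_left⟩
    by_cases hCB : C = B
    · exact ⟨A ∪ B, by simp [hQ], hCB ▸ Finset.subset_union_right⟩
    exact ⟨C, by simp [hQ, hC, hCA, hCB], le_rfl⟩
  · rw [hQ, Finset.card_insert_of_notMem hnot,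
      Finset.card_erase_of_mem (Finset.mem_erase.2 ⟨hAB.symm, hB⟩), Finset.card_erase_of_mem hA]
    omega

/-- The algorithm always returns a path. -/
theorem exists_isReturnedPath (x : Fin n → Fin d → ℝ) (w : ℝ) :
    ∃ P, IsReturnedPath x w P := by
  have step : ∀ (G : IdxPartition d) (i : ℕ), ∃ H : IdxPartition d,
      1 ≤ i → G.parts.card = i + 1 → H ∈ candidates G i ∧
        ∀ K ∈ candidates G i, criterion x w G H ≤ criterion x w G K := by
    intro G i
    by_cases h : 1 ≤ i ∧ G.parts.card = i + 1
    · obtain ⟨H, hH, hmin⟩ := Set.exists_min_image (candidates G i) (criterion x w G)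
        (Set.toFinite _) (candidates_nonempty G h.1 h.2)
      exact ⟨H, fun _ _ => ⟨hH, hmin⟩⟩
    · exact ⟨G, fun h1 h2 => absurd ⟨h1, h2⟩ h⟩
  choose nxt hnxt using step
  let f : ℕ → IdxPartition d := fun k => Nat.rec ⊥ (fun k G => nxt G (d - (k + 1))) k
  have hf0 : f 0 = ⊥ := rfl
  have hfs : ∀ k, f (k + 1) = nxt (f k) (d - (k + 1)) := fun _ => rfl
  have hcard : ∀ k, k < d → (f k).parts.card = d - k := by
    intro k
    induction k with
    | zero => intro _; rw [hf0, Finpartition.card_bot]; simp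
    | succ k ih =>
      intro hk
      rw [hfs]
      exact (hnxt (f k) (d - (k + 1)) (by omega) (by rw [ih (by omega)]; omega)).1.2
  refine ⟨_, fun i => f (d - i), by simp [hf0], ?_, rfl⟩
  intro i h1 hd
  have e1 : d - i = d - (i + 1) + 1 := by omega
  have e2 : d - (d - (i + 1) + 1) = i := by omega
  have key := hnxt (f (d - (i + 1))) i h1 (by rw [hcard _ (by omega)]; omega)
  have e3 : f (d - i) = nxt (f (d - (i + 1))) i := by rw [e1, hfs, e2]
  simp only [e3]
  exact key

end

end KendallPath

open KendallPath

/-!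
The path contains `G` as soon as, at every step that starts from a refinement `H` of `G`, each
candidate that refines `G` beats each candidate that does not: the path then stays below `G` until
it has as many clusters as `G`, and so passes through `G` (`IsReturnedPath.mem_of_criterion_lt`).
There are finitely many comparisons, and each holds with probability tending to `1`.

*Refinements of `G` are the exchangeable partitions.*  Interchangeability of two coordinates of the
copula is an equivalence relation, because the transposition `(a c)` is the conjugate of
`(b c)` by `(a b)`.  A partition satisfies the partial exchangeability assumption iff its clusters
lie in the classes of this relation, so the classes form the coarsest such partition and the others
are its refinements (`IsCoarsestPEA.pea_iff_le`).  By the assumption on `Γ`, the limit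
`Γ_K τ - τ` of the residual vanishes iff `K` refines `G`.

*The covariance estimate.*  Under an exchangeable `H`, `n Σ̃_w(H)` converges in probability to
`Σ_∞` (`tendsto_SigmaTildeW`).  The estimators `τ̂` and `Θ̂` are U-statistics with bounded kernels,
up to a term of smaller order, and obey a weak law of large numbers by a second-moment bound
(`tendsto_uStat_inProb`).  Since the marginals are continuous, the probability integral transform
identifies the limits with `τ` and the `θ`s of the copula.  Averaging over entry classes does not
change the limit: two entries in one class are related by a cluster-preserving permutation
(`eq_of_block_eq_of_overlap_eq`).

*Comparison.*  Multiplied by `1 / n`, the criterion for a candidate `K` converges in probability to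
`(τ - Γ_K τ)ᵀ Σ_∞⁻¹ (τ - Γ_K τ)`, which is zero if `K` refines `G` and positive otherwise
(`eventually_criterion_lt`).
-/

namespace KendallPath

noncomputable section

/-! ### Partitions and cluster-preserving permutations -/

section Partitions

variable {d : ℕ}

theorem mem_part_self (G : IdxPartition d) (a : Fin d) : a ∈ G.part a :=
  G.mem_part_self.2 (Finset.mem_univ a)

theorem part_mem_parts (G : IdxPartition d) (a : Fin d) : G.part a ∈ G.parts :=
  G.part_mem.2 (Finset.mem_univ a)

theorem le_iff_part_eq {K G : IdxPartition d} :
    K ≤ G ↔ ∀ a b, K.part a = K.part b → G.part a = G.part b := by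
  constructor
  · intro h a b hab
    obtain ⟨q, hq, hle⟩ := h (part_mem_parts K a)
    rw [G.part_eq_of_mem hq (hle (mem_part_self K a)),
      G.part_eq_of_mem hq (hle (hab ▸ mem_part_self K b))]
  · intro h p hp
    obtain ⟨a, ha⟩ := K.nonempty_of_mem_parts hp
    refine ⟨G.part a, part_mem_parts G a, fun b hb => ?_⟩
    rw [h a b (by rw [K.part_eq_of_mem hp ha, K.part_eq_of_mem hp hb])]
    exact mem_part_self G b

theorem eq_of_le_of_card_le {K G : IdxPartition d} (h : K ≤ G)
    (hc : K.parts.card ≤ G.parts.card) : K = G := by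
  refine le_antisymm h (le_iff_part_eq.2 fun a b hab => ?_)
  have hex : ∀ q ∈ G.parts, ∃ p ∈ K.parts, p ≤ q := fun q hq => Finpartition.exists_le_of_le h hq
  choose! g hg hgle using hex
  have hinj : Set.InjOn g G.parts := by
    intro q hq q' hq' e
    obtain ⟨x, hx⟩ := K.nonempty_of_mem_parts (hg q hq)
    exact G.eq_of_mem_parts hq hq' (hgle q hq hx) (hgle q' hq' (e ▸ hx))
  -- every cluster of `G` contains a cluster of `K`; there are no other clusters of `K`
  have hsurj := Finset.surjOn_of_injOn_of_card_le g hg hinj hc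
  obtain ⟨q, hq, hqa⟩ := hsurj (part_mem_parts K a)
  obtain ⟨q', hq', hqb⟩ := hsurj (part_mem_parts K b)
  have ha : a ∈ q := hgle q hq (hqa ▸ mem_part_self K a)
  have hb : b ∈ q' := hgle q' hq' (hqb ▸ mem_part_self K b)
  have : q = q' := by rw [← G.part_eq_of_mem hq ha, ← G.part_eq_of_mem hq' hb, hab]
  rw [← hqa, ← hqb, this]

/-- If `K` refines `G` strictly, two clusters of `K` can be merged so that the result still
refines `G`. -/
theorem exists_candidate_le {K G : IdxPartition d} (h : K ≤ G) {i : ℕ}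
    (hK : K.parts.card = i + 1) (hG : G.parts.card ≤ i) : ∃ L ∈ candidates K i, L ≤ G := by
  classical
  have : ∃ a b, G.part a = G.part b ∧ K.part a ≠ K.part b := by
    by_contra! hne
    have := Finpartition.card_mono (le_iff_part_eq.2 hne)
    omega
  obtain ⟨a, b, hG', hab⟩ := this
  -- the merger is the partition into the fibres of `c`, which sends the cluster of `b` to that of `a`
  let c : Fin d → Finset (Fin d) := fun x => if K.part x = K.part b then K.part a else K.part x
  let L : IdxPartition d := Finpartition.ofSetoid (Setoid.ker c)
  have hL : ∀ x y, L.part x = L.part y ↔ c x = c y := by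
    intro x y
    rw [← L.mem_part_iff_part_eq_part (Finset.mem_univ _) (Finset.mem_univ _),
      Finpartition.mem_part_ofSetoid_iff_rel, Setoid.ker_def, eq_comm]
  refine ⟨L, ⟨le_iff_part_eq.2 fun x y hxy => (hL x y).2 (by simp [c, hxy]), ?_⟩,
    le_iff_part_eq.2 fun x y hxy => ?_⟩
  · have hparts : L.parts = (Finset.univ.image c).image
        (fun v => Finset.univ.filter fun y => v = c y) := by
      rw [Finset.image_image]
      ext p
      simp [L, Finpartition.ofSetoid, Finpartition.ofSetSetoid, Setoid.ker_def]
    have himg : Finset.univ.image c = K.parts.erase (K.part b) := by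
      ext p
      simp only [Finset.mem_image, Finset.mem_univ, true_and, Finset.mem_erase]
      constructor
      · rintro ⟨x, rfl⟩
        by_cases hx : K.part x = K.part b
        · simp [c, hx, hab]
        · simp [c, hx]
      · rintro ⟨hpb, hp⟩
        obtain ⟨x, hx⟩ := K.nonempty_of_mem_parts hp
        have hxp := K.part_eq_of_mem hp hx
        exact ⟨x, by simp [c, hxp, hpb]⟩
    rw [hparts, Finset.card_image_of_injOn, himg, Finset.card_erase_of_mem (part_mem_parts K b), hK]
    · rfl
    · intro v hv v' _ e
      obtain ⟨x, -, rfl⟩ := Finset.mem_image.1 hv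
      have : x ∈ Finset.univ.filter fun y => v' = c y := by
        simp only at e
        rw [← e]; simp
      simpa using (Finset.mem_filter.1 this).2.symm
  · have hc : ∀ x, ∃ x', c x = K.part x' ∧ G.part x' = G.part x := by
      intro x
      by_cases hx : K.part x = K.part b
      · exact ⟨a, by simp [c, hx], hG'.trans (le_iff_part_eq.1 h x b hx).symm⟩
      · exact ⟨x, by simp [c, hx], rfl⟩
    obtain ⟨x', hx', hx⟩ := hc x
    obtain ⟨y', hy', hy⟩ := hc y
    rw [← hx, ← hy]
    exact le_iff_part_eq.1 h _ _ (by rw [← hx', ← hy']; exact (hL x y).1 hxy)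

/-- A partial injection that preserves the colours `c` extends to an element of any permutation
group that contains all transpositions of points of the same colour. -/
theorem exists_mem_eqOn {α β : Type*} [DecidableEq α] (N : Subgroup (Equiv.Perm α)) (c : α → β)
    (hN : ∀ a b, c a = c b → Equiv.swap a b ∈ N) (S : Finset α) (f : α → α)
    (hf : Set.InjOn f S) (hc : ∀ a ∈ S, c (f a) = c a) :
    ∃ π ∈ N, (∀ x, c (π x) = c x) ∧ ∀ a ∈ S, π a = f a := by
  induction S using Finset.induction_on with
  | empty => exact ⟨1, N.one_mem, fun _ => rfl, by simp⟩
  | insert a S ha ih =>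
    obtain ⟨π, hπN, hπc, hπ⟩ := ih (hf.mono (by simp)) fun b hb => hc b (Finset.mem_insert_of_mem hb)
    have hcol : c (π a) = c (f a) := by rw [hπc, hc a (Finset.mem_insert_self a S)]
    refine ⟨Equiv.swap (π a) (f a) * π, N.mul_mem (hN _ _ hcol) hπN, fun x => ?_, fun b hb => ?_⟩
    · rw [Equiv.Perm.mul_apply, Equiv.swap_apply_def]
      split_ifs with h1 h2
      · rw [← hcol, ← h1, hπc]
      · rw [hcol, ← h2, hπc]
      · exact hπc x
    · rcases Finset.mem_insert.1 hb with rfl | hbS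
      · simp
      · have hne : b ≠ a := fun e => ha (e ▸ hbS)
        rw [Equiv.Perm.mul_apply,
          Equiv.swap_apply_of_ne_of_ne (fun e => hne (π.injective e)), hπ b hbS]
        rw [hπ b hbS]
        exact fun e => hne (hf (by simp [hbS]) (by simp) e)

end Partitions

/-! ### Partial exchangeability as invariance under transpositions -/

section Exchangeability

variable {d : ℕ}

/-- The group of the coordinate permutations that leave the measure `Q` invariant. -/
def exchGroup (Q : Measure (Fin d → ℝ)) : Subgroup (Equiv.Perm (Fin d)) where
  carrier := {π | Q.map (fun u j => u (π j)) = Q}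
  one_mem' := by
    change Q.map id = Q
    exact Measure.map_id
  mul_mem' := by
    intro π σ hπ hσ
    have hm : ∀ ρ : Equiv.Perm (Fin d), Measurable fun (u : Fin d → ℝ) j => u (ρ j) := by
      intro ρ; fun_prop
    have h := Measure.map_map (μ := Q) (hm σ) (hm π)
    rw [hπ.out, hσ.out] at h
    exact h.symm
  inv_mem' := by
    intro π hπ
    have hm : ∀ ρ : Equiv.Perm (Fin d), Measurable fun (u : Fin d → ℝ) j => u (ρ j) := by
      intro ρ; fun_prop
    have h := Measure.map_map (μ := Q) (hm π⁻¹) (hm π)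
    rw [hπ.out] at h
    change Q.map (fun u j => u (π⁻¹ j)) = Q
    rw [h]
    convert! Measure.map_id
    ext u j
    simp

theorem mem_exchGroup {Q : Measure (Fin d → ℝ)} {π : Equiv.Perm (Fin d)} :
    π ∈ exchGroup Q ↔ Q.map (fun u j => u (π j)) = Q := Iff.rfl

theorem pea_iff_swap_mem {ν : Measure (Fin d → ℝ)} {G : IdxPartition d} :
    PEA ν G ↔ ∀ a b, G.part a = G.part b → Equiv.swap a b ∈ exchGroup (copulaLaw ν) := by
  constructor
  · intro h a b hab
    refine h _ fun j A hA => ?_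
    have hmem : ∀ x, x ∈ A ↔ G.part x = A := fun x => (G.part_eq_iff_mem hA).symm
    rw [Equiv.swap_apply_def]
    split_ifs with h1 h2
    · rw [hmem, hmem, h1, hab]
    · rw [hmem, hmem, h2, hab]
    · rfl
  · intro h π hπ
    obtain ⟨σ, hσ, -, hσπ⟩ := exists_mem_eqOn (exchGroup (copulaLaw ν)) G.part h Finset.univ π
      π.injective.injOn fun a _ => G.part_eq_of_mem (part_mem_parts G a)
        ((hπ a _ (part_mem_parts G a)).1 (mem_part_self G a))
    have : σ = π := Equiv.ext fun a => hσπ a (Finset.mem_univ a)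
    exact this ▸ hσ

/-- Interchangeability of two coordinates is an equivalence relation.  Its classes form the
coarsest partition that satisfies the partial exchangeability assumption, and the partitions that
satisfy it are exactly the refinements of that one. -/
theorem IsCoarsestPEA.pea_iff_le {ν : Measure (Fin d → ℝ)} {G : IdxPartition d}
    (hG : IsCoarsestPEA ν G) (K : IdxPartition d) : PEA ν K ↔ K ≤ G := by
  classical
  let N := exchGroup (copulaLaw ν)
  let s : Setoid (Fin d) :=
    { r := fun a b => Equiv.swap a b ∈ N
      iseqv := ⟨fun a => by rw [Equiv.swap_self]; exact N.one_mem,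
        fun {a b} h => by rw [Equiv.swap_comm]; exact h,
        fun h h' => SubmonoidClass.swap_mem_trans N h h'⟩ }
  let M : IdxPartition d := Finpartition.ofSetoid s
  have hM : ∀ a b, M.part a = M.part b ↔ Equiv.swap a b ∈ N := by
    intro a b
    rw [eq_comm, ← M.mem_part_iff_part_eq_part (Finset.mem_univ _) (Finset.mem_univ _)]
    exact Finpartition.mem_part_ofSetoid_iff_rel
  have key : ∀ K : IdxPartition d, PEA ν K ↔ K ≤ M := by
    intro K
    rw [pea_iff_swap_mem, le_iff_part_eq]
    simp only [hM]
    rfl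
  have : G = M := eq_of_le_of_card_le ((key G).1 hG.1) (hG.2 M ((key M).2 le_rfl))
  rw [this]
  exact key K

end Exchangeability

/-! ### Convergence in probability as convergence along a filter -/

section InProb

variable {Ω : Type*} [MeasurableSpace Ω]

/-- The filter on `ℕ × Ω` of the properties `A n ω` that hold with probability tending to `1` as
`n → ∞`.  Convergence in probability of `Z n ω` to a constant `a` is convergence along this filter,
so that the continuous mapping theorem is composition of limits.  No measurability is required, `μ`
being used as an outer measure. -/
def inProb (μ : Measure Ω) : Filter (ℕ × Ω) where
  sets := {A | Tendsto (fun n => μ {ω | (n, ω) ∉ A}) atTop (𝓝 0)}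
  univ_sets := by simp
  sets_of_superset := by
    intro A B hA hAB
    exact tendsto_of_tendsto_of_tendsto_of_le_of_le tendsto_const_nhds hA (fun _ => zero_le)
      fun n => measure_mono fun ω hω h => hω (hAB h)
  inter_sets := by
    intro A B hA hB
    have hAB := Tendsto.add hA hB
    rw [add_zero] at hAB
    refine tendsto_of_tendsto_of_tendsto_of_le_of_le tendsto_const_nhds hAB (fun _ => zero_le)
      fun n => (measure_mono ?_).trans (measure_union_le _ _)
    intro ω hω
    by_contra hcon
    simp only [Set.mem_union, Set.mem_ofPred_eq, not_or, not_not] at hcon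
    exact hω ⟨hcon.1, hcon.2⟩

theorem eventually_inProb {μ : Measure Ω} {p : ℕ × Ω → Prop} :
    (∀ᶠ z in inProb μ, p z) ↔ Tendsto (fun n => μ {ω | ¬ p (n, ω)}) atTop (𝓝 0) := Iff.rfl

theorem tendsto_fst_inProb (μ : Measure Ω) : Tendsto Prod.fst (inProb μ) atTop := by
  refine tendsto_atTop.2 fun N => eventually_inProb.2 ?_
  refine tendsto_const_nhds.congr' ?_
  filter_upwards [eventually_ge_atTop N] with n hn
  simp [hn]

theorem tendsto_measure_of_eventually_inProb {μ : Measure Ω} [IsProbabilityMeasure μ]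
    {p : ℕ × Ω → Prop} (h : ∀ᶠ z in inProb μ, p z) :
    Tendsto (fun n => μ {ω | p (n, ω)}) atTop (𝓝 1) := by
  have h1 : Tendsto (fun n => 1 - μ {ω | ¬ p (n, ω)}) atTop (𝓝 (1 - 0)) :=
    ENNReal.Tendsto.sub tendsto_const_nhds (eventually_inProb.1 h) (Or.inl ENNReal.one_ne_top)
  rw [tsub_zero] at h1
  refine tendsto_of_tendsto_of_tendsto_of_le_of_le h1 tendsto_const_nhds (fun n => ?_)
    fun n => prob_le_one
  rw [tsub_le_iff_right]
  calc 1 = μ Set.univ := measure_univ.symm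
    _ ≤ μ ({ω | p (n, ω)} ∪ {ω | ¬ p (n, ω)}) := measure_mono fun ω _ => by
        simpa using em (p (n, ω))
    _ ≤ _ := measure_union_le _ _

/-- Chebyshev: convergence of the second moments to `0` implies convergence in probability. -/
theorem tendsto_inProb_of_tendsto_integral_sq {μ : Measure Ω} [IsProbabilityMeasure μ]
    {Z : ℕ × Ω → ℝ} (hint : ∀ n, Integrable (fun ω => Z (n, ω) ^ 2) μ)
    (h : Tendsto (fun n => ∫ ω, Z (n, ω) ^ 2 ∂μ) atTop (𝓝 0)) :
    Tendsto Z (inProb μ) (𝓝 0) := by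
  rw [Metric.tendsto_nhds]
  intro ε hε
  refine eventually_inProb.2 ?_
  have hreal : Tendsto (fun n => μ.real {ω | ε ^ 2 ≤ Z (n, ω) ^ 2}) atTop (𝓝 0) := by
    have h2 := h.const_mul (ε ^ 2)⁻¹
    rw [mul_zero] at h2
    refine squeeze_zero (fun _ => measureReal_nonneg) (fun n => ?_) h2
    rw [le_inv_mul_iff₀ (by positivity)]
    exact mul_meas_ge_le_integral_of_nonneg (ae_of_all _ fun ω => sq_nonneg _) (hint n) _
  have h3 := ENNReal.tendsto_ofReal hreal
  rw [ENNReal.ofReal_zero] at h3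
  refine h3.congr fun n => ?_
  rw [ofReal_measureReal]
  congr 1
  ext ω
  simp only [Set.mem_ofPred_eq, dist_zero_right, Real.norm_eq_abs, not_lt]
  rw [sq_le_sq, abs_of_pos hε]

end InProb

/-! ### A weak law of large numbers for U-statistics -/

section WeakLaw

theorem tendsto_descFactorial_div_pow (m : ℕ) :
    Tendsto (fun n : ℕ => (n.descFactorial m : ℝ) / (n : ℝ) ^ m) atTop (𝓝 1) := by
  refine (Asymptotics.isEquivalent_iff_tendsto_one ?_).1 (isEquivalent_descFactorial m)
  filter_upwards [eventually_gt_atTop 0] with n hn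
  positivity

theorem card_injective_eq_descFactorial {ι : Type*} [Fintype ι] [DecidableEq ι] (n : ℕ)
    [DecidablePred fun t : ι → Fin n => Function.Injective t] :
    (Finset.univ.filter fun t : ι → Fin n => Function.Injective t).card
      = n.descFactorial (Fintype.card ι) := by
  classical
  rw [← Fintype.card_subtype, Fintype.card_congr (Equiv.subtypeInjectiveEquivEmbedding ι (Fin n)),
    Fintype.card_embedding_eq, Fintype.card_fin]

variable {Ω : Type*} [MeasurableSpace Ω] {μ : Measure Ω} [IsProbabilityMeasure μ]
  {κ : Type*} [Fintype κ]

/-- In the second moment of the sum, only the pairs of multi-indices with a repeated entry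
contribute, and their proportion tends to `0`. -/
theorem tendsto_average_inProb [DecidableEq κ] (Z : (κ → ℕ) → Ω → ℝ) {C : ℝ}
    (hm : ∀ t, AEStronglyMeasurable (Z t) μ) (hb : ∀ t ω, |Z t ω| ≤ C)
    (hu : ∀ t t', Function.Injective (Sum.elim t t') → ∫ ω, Z t ω * Z t' ω ∂μ = 0) :
    Tendsto (fun p : ℕ × Ω =>
      (∑ t : κ → Fin p.1, Z (fun i => t i) p.2) / (p.1 : ℝ) ^ Fintype.card κ)
      (inProb μ) (𝓝 0) := by
  classical
  have hprod : ∀ t t', Integrable (fun ω => Z t ω * Z t' ω) μ := by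
    intro t t'
    refine Integrable.of_bound ((hm t).mul (hm t')) (C * C) (ae_of_all _ fun ω => ?_)
    rw [Real.norm_eq_abs, abs_mul]
    exact mul_le_mul (hb t ω) (hb t' ω) (abs_nonneg _) ((abs_nonneg _).trans (hb t ω))
  have hsq : ∀ (n : ℕ) ω, ((∑ t : κ → Fin n, Z (fun i => t i) ω) / (n : ℝ) ^ Fintype.card κ) ^ 2
      = (∑ t : κ → Fin n, ∑ t' : κ → Fin n, Z (fun i => t i) ω * Z (fun i => t' i) ω)
        / (n : ℝ) ^ (2 * Fintype.card κ) := by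
    intro n ω
    rw [div_pow, sq (∑ t : κ → Fin n, _), Finset.sum_mul_sum, ← pow_mul, mul_comm 2]
  have hint : ∀ n : ℕ, Integrable (fun ω => ∑ t : κ → Fin n, ∑ t' : κ → Fin n,
      Z (fun i => t i) ω * Z (fun i => t' i) ω) μ := fun n =>
    integrable_finsetSum _ fun t _ => integrable_finsetSum _ fun t' _ => hprod _ _
  apply tendsto_inProb_of_tendsto_integral_sq
  · intro n
    simp only [hsq]
    exact (hint n).div_const _
  have hlim : Tendsto (fun n : ℕ => C ^ 2 *
      (1 - (n.descFactorial (2 * Fintype.card κ) : ℝ) / (n : ℝ) ^ (2 * Fintype.card κ)))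
      atTop (𝓝 0) := by
    have := ((tendsto_const_nhds (x := (1 : ℝ))).sub
      (tendsto_descFactorial_div_pow (2 * Fintype.card κ))).const_mul (C ^ 2)
    simpa using this
  refine tendsto_of_tendsto_of_tendsto_of_le_of_le' tendsto_const_nhds hlim
    (Eventually.of_forall fun n => integral_nonneg fun ω => sq_nonneg _) ?_
  filter_upwards [eventually_gt_atTop 0] with n hn
  simp only [hsq]
  rw [integral_div, integral_finsetSum _ fun t _ => integrable_finsetSum _ fun t' _ => hprod _ _]
  have hpos : (0 : ℝ) < (n : ℝ) ^ (2 * Fintype.card κ) := by positivity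
  rw [div_le_iff₀ hpos, mul_assoc, sub_mul, one_mul, div_mul_cancel₀ _ hpos.ne']
  calc ∑ t : κ → Fin n, ∫ ω, ∑ t' : κ → Fin n, Z (fun i => t i) ω * Z (fun i => t' i) ω ∂μ
      = ∑ t : κ → Fin n, ∑ t' : κ → Fin n, ∫ ω, Z (fun i => t i) ω * Z (fun i => t' i) ω ∂μ :=
        Finset.sum_congr rfl fun t _ => integral_finsetSum _ fun t' _ => hprod _ _
    _ ≤ ∑ t : κ → Fin n, ∑ t' : κ → Fin n,
          (C ^ 2 - if Function.Injective (Sum.elim t t') then C ^ 2 else 0) := by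
        refine Finset.sum_le_sum fun t _ => Finset.sum_le_sum fun t' _ => ?_
        split_ifs with h
        · rw [hu _ _ ?_, sub_self]
          have h2 := Fin.val_injective.comp h
          rwa [Sum.comp_elim] at h2
        · rw [sub_zero]
          refine (le_abs_self _).trans ?_
          rw [← Real.norm_eq_abs]
          refine (norm_integral_le_of_norm_le_const (C := C ^ 2) (ae_of_all _ fun ω => ?_)).trans
            (by simp)
          rw [Real.norm_eq_abs, abs_mul, sq]
          exact mul_le_mul (hb _ ω) (hb _ ω) (abs_nonneg _)
            ((abs_nonneg _).trans (hb (fun i => t i) ω))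
    _ = ∑ t : κ ⊕ κ → Fin n, (C ^ 2 - if Function.Injective t then C ^ 2 else 0) := by
        rw [← Fintype.sum_prod_type']
        refine (Fintype.sum_equiv (Equiv.sumArrowEquivProdArrow κ κ (Fin n)) _ _ fun t => ?_).symm
        simp only [Equiv.sumArrowEquivProdArrow, Equiv.coe_fn_mk, Sum.elim_comp_inl_inr]
    _ = C ^ 2 * ((n : ℝ) ^ (2 * Fintype.card κ)
          - (n.descFactorial (2 * Fintype.card κ) : ℝ)) := by
        rw [Finset.sum_sub_distrib, ← Finset.sum_filter, Finset.sum_const, Finset.sum_const,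
          card_injective_eq_descFactorial n]
        simp [← two_mul]
        ring

/-- The weak law of large numbers for U-statistics with a bounded kernel `h`, for a possibly
non-symmetric kernel whose arguments are labelled by `κ`. -/
theorem tendsto_uStat_inProb [DecidableEq κ] {E : Type*} [MeasurableSpace E] {X : ℕ → Ω → E}
    (hX : ∀ k, AEMeasurable (X k) μ) (hindep : iIndepFun X μ) {h : (κ → E) → ℝ}
    (hm : Measurable h) {C : ℝ} (hb : ∀ z, |h z| ≤ C) {θ : ℝ}
    (hθ : ∀ t : κ → ℕ, Function.Injective t → ∫ ω, h (fun i => X (t i) ω) ∂μ = θ)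
    [∀ n, DecidablePred fun t : κ → Fin n => Function.Injective t] :
    Tendsto (fun p : ℕ × Ω => (∑ t : κ → Fin p.1,
      if Function.Injective t then h (fun i => X (t i) p.2) else 0) / (p.1 : ℝ) ^ Fintype.card κ)
      (inProb μ) (𝓝 θ) := by
  classical
  let Z : (κ → ℕ) → Ω → ℝ := fun t ω =>
    (if Function.Injective t then h (fun i => X (t i) ω) else 0) - θ
  have hXm : ∀ t : κ → ℕ, AEMeasurable (fun ω i => X (t i) ω) μ := fun t =>
    aemeasurable_pi_lambda _ fun i => hX (t i)
  have hhm : ∀ t : κ → ℕ, AEStronglyMeasurable (fun ω => h (fun i => X (t i) ω)) μ := fun t =>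
    (hm.comp_aemeasurable (hXm t)).aestronglyMeasurable
  have hhi : ∀ t : κ → ℕ, Integrable (fun ω => h (fun i => X (t i) ω)) μ := fun t =>
    Integrable.of_bound (hhm t) C (ae_of_all _ fun ω => hb _)
  have hZm : ∀ t, AEStronglyMeasurable (Z t) μ := by
    intro t
    by_cases ht : Function.Injective t
    · simp only [Z, ht, if_true]
      exact (hhm t).sub aestronglyMeasurable_const
    · simpa [Z, ht] using aestronglyMeasurable_const
  have hZb : ∀ t ω, |Z t ω| ≤ C + |θ| := by
    intro t ω
    refine (abs_sub _ _).trans (add_le_add ?_ le_rfl)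
    split_ifs
    · exact hb _
    · rw [abs_zero]; exact (abs_nonneg _).trans (hb fun i => X (t i) ω)
  have hZ0 : ∀ t, Function.Injective t → ∫ ω, Z t ω ∂μ = 0 := by
    intro t ht
    simp only [Z, ht, if_true]
    rw [integral_sub (hhi t) (integrable_const _), hθ t ht]
    simp
  have hZu : ∀ t t', Function.Injective (Sum.elim t t') → ∫ ω, Z t ω * Z t' ω ∂μ = 0 := by
    intro t t' htt
    obtain ⟨ht, ht', hne⟩ := (Sum.elim_injective).1 htt
    have hdisj : Disjoint (Finset.univ.image t) (Finset.univ.image t') := by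
      rw [Finset.disjoint_left]
      intro x hx hx'
      obtain ⟨i, -, rfl⟩ := Finset.mem_image.1 hx
      obtain ⟨j, -, hj⟩ := Finset.mem_image.1 hx'
      exact hne i j hj.symm
    have hind := hindep.indepFun_finset₀ _ _ hdisj hX
    let φ : ∀ s : κ → ℕ, (Finset.univ.image s → E) → ℝ := fun s z =>
      h (fun i => z ⟨s i, Finset.mem_image_of_mem s (Finset.mem_univ i)⟩) - θ
    have hφ : ∀ s, Measurable (φ s) := by
      intro s
      refine (hm.comp ?_).sub_const θ
      exact measurable_pi_lambda _ fun i => measurable_pi_apply _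
    have hind2 := hind.comp (hφ t) (hφ t')
    have hZt : ∀ s, Function.Injective s →
        (φ s ∘ fun ω (i : Finset.univ.image s) => X i ω) = Z s := by
      intro s hs
      funext ω
      simp [φ, Z, hs]
    rw [hZt t ht, hZt t' ht'] at hind2
    rw [hind2.integral_fun_mul_eq_mul_integral (hZm t) (hZm t'), hZ0 t ht, zero_mul]
  have hlim := (tendsto_average_inProb Z hZm hZb hZu).add_const θ
  rw [zero_add] at hlim
  refine hlim.congr' ?_
  filter_upwards [(tendsto_fst_inProb μ).eventually (eventually_gt_atTop 0)] with p hp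
  have hpos : (p.1 : ℝ) ^ Fintype.card κ ≠ 0 := by
    have : (0 : ℝ) < p.1 := by exact_mod_cast hp
    positivity
  have hinj : ∀ t : κ → Fin p.1, Function.Injective (fun i => (t i : ℕ)) ↔ Function.Injective t :=
    fun t => Fin.val_injective.of_comp_iff t
  simp only [Z, hinj, Finset.sum_sub_distrib, Finset.sum_const]
  rw [div_add' _ _ _ hpos]
  simp [mul_comm]

end WeakLaw

/-! ### Continuous marginals: ties and the probability integral transform -/

section Copula

theorem measure_Icc_of_continuous_cdf (m : Measure ℝ) [IsProbabilityMeasure m]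
    (h : Continuous (cdf m)) (a b : ℝ) : m (Set.Icc a b) = ENNReal.ofReal (cdf m b - cdf m a) := by
  have h1 := (cdf m).measure_Icc a b
  rwa [measure_cdf, (h.continuousAt (x := a)).continuousWithinAt.leftLim_eq] at h1

/-- A continuous distribution function is flat only on null sets. -/
theorem measure_cdf_levelSet (m : Measure ℝ) [IsProbabilityMeasure m]
    (h : Continuous (cdf m)) (c : ℝ) : m {y | cdf m y = c} = 0 := by
  have hcl : IsClosed {y | cdf m y = c} := isClosed_eq h continuous_const
  rw [hcl.measurableSet.measure_eq_iSup_isCompact m]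
  simp only [ENNReal.iSup_eq_zero]
  intro K hKs hK
  rcases K.eq_empty_or_nonempty with rfl | hne
  · simp
  · refine measure_mono_null (t := Set.Icc (sInf K) (sSup K))
      (fun x hx => ⟨csInf_le hK.bddBelow hx, le_csSup hK.bddAbove hx⟩) ?_
    rw [measure_Icc_of_continuous_cdf m h, (hKs (hK.sSup_mem hne)).out,
      (hKs (hK.sInf_mem hne)).out]
    simp

theorem measurableSet_lt_and_lt {α : Type*} [MeasurableSpace α] {f g f' g' : α → ℝ}
    (hf : Measurable f) (hg : Measurable g) (hf' : Measurable f') (hg' : Measurable g') :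
    MeasurableSet {a | f a < g a ∧ f' a < g' a} :=
  (measurableSet_lt hf hg).inter (measurableSet_lt hf' hg')

theorem measurableSet_le_and_le {α : Type*} [MeasurableSpace α] {f g f' g' : α → ℝ}
    (hf : Measurable f) (hg : Measurable g) (hf' : Measurable f') (hg' : Measurable g') :
    MeasurableSet {a | f a ≤ g a ∧ f' a ≤ g' a} :=
  (measurableSet_le hf hg).inter (measurableSet_le hf' hg')

variable {d : ℕ} {ν : Measure (Fin d → ℝ)}

theorem margCdf_mono (j : Fin d) : Monotone (margCdf ν j) := monotone_cdf _

theorem measurable_margCdf :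
    Measurable fun (y : Fin d → ℝ) j => margCdf ν j (y j) :=
  measurable_pi_lambda _ fun j => (margCdf_mono j).measurable.comp (measurable_pi_apply j)

theorem integral_copulaLaw {f : (Fin d → ℝ) → ℝ} (hf : Measurable f) :
    ∫ u, f u ∂(copulaLaw ν) = ∫ x, f (fun j => margCdf ν j (x j)) ∂ν :=
  integral_map measurable_margCdf.aemeasurable hf.aestronglyMeasurable

variable [IsProbabilityMeasure ν]

instance isProbabilityMeasure_map_eval (j : Fin d) : IsProbabilityMeasure (ν.map fun y => y j) :=
  Measure.isProbabilityMeasure_map (measurable_pi_apply j).aemeasurable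

theorem ae_margCdf_ne (hcont : ∀ j, Continuous (margCdf ν j)) (j : Fin d) (x : ℝ) :
    ∀ᵐ y ∂ν, margCdf ν j (y j) ≠ margCdf ν j x := by
  have h := measure_cdf_levelSet (ν.map fun y : Fin d → ℝ => y j) (hcont j) (margCdf ν j x)
  rw [Measure.map_apply (measurable_pi_apply j)
    (isClosed_eq (hcont j) continuous_const).measurableSet] at h
  rw [ae_iff]
  simp only [ne_eq, not_not]
  exact h

instance isProbabilityMeasure_copulaLaw : IsProbabilityMeasure (copulaLaw ν) :=
  Measure.isProbabilityMeasure_map measurable_margCdf.aemeasurable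

/-- The indicator that `x` lies strictly below `y` in both coordinates of the position `r`. -/
def lower (r : Pos d) (x y : Fin d → ℝ) : ℝ :=
  if x r.1.1 < y r.1.1 ∧ x r.1.2 < y r.1.2 then 1 else 0

theorem measurableSet_lower (r : Pos d) :
    MeasurableSet {z : (Fin d → ℝ) × (Fin d → ℝ) | z.1 r.1.1 < z.2 r.1.1 ∧ z.1 r.1.2 < z.2 r.1.2} :=
  measurableSet_lt_and_lt (by fun_prop) (by fun_prop) (by fun_prop) (by fun_prop)

theorem measurable_lower (r : Pos d) :
    Measurable fun z : (Fin d → ℝ) × (Fin d → ℝ) => lower r z.1 z.2 :=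
  Measurable.ite (measurableSet_lower r) measurable_const measurable_const

theorem lower_nonneg (r : Pos d) (x y : Fin d → ℝ) : 0 ≤ lower r x y := by
  unfold lower; split_ifs <;> norm_num

theorem lower_le_one (r : Pos d) (x y : Fin d → ℝ) : lower r x y ≤ 1 := by
  unfold lower; split_ifs <;> norm_num

theorem abs_lower_le_one (r : Pos d) (x y : Fin d → ℝ) : |lower r x y| ≤ 1 := by
  rw [abs_of_nonneg (lower_nonneg r x y)]
  exact lower_le_one r x y

theorem copC_margCdf (hcont : ∀ j, Continuous (margCdf ν j)) (r : Pos d) (x : Fin d → ℝ) :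
    copC ν r (fun j => margCdf ν j (x j)) = ∫ y, lower r y x ∂ν := by
  have hm : MeasurableSet {v : Fin d → ℝ | v r.1.1 ≤ margCdf ν r.1.1 (x r.1.1) ∧
      v r.1.2 ≤ margCdf ν r.1.2 (x r.1.2)} :=
    measurableSet_le_and_le (by fun_prop) (by fun_prop) (by fun_prop) (by fun_prop)
  have hs : MeasurableSet {y : Fin d → ℝ | y r.1.1 < x r.1.1 ∧ y r.1.2 < x r.1.2} :=
    measurableSet_lt_and_lt (by fun_prop) (by fun_prop) (by fun_prop) (by fun_prop)
  have hl : (fun y => lower r y x)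
      = {y : Fin d → ℝ | y r.1.1 < x r.1.1 ∧ y r.1.2 < x r.1.2}.indicator 1 := by
    funext y; simp [lower, Set.indicator_apply]
  rw [hl, integral_indicator_one hs, copC, copulaLaw,
    map_measureReal_apply measurable_margCdf hm]
  refine measureReal_congr ?_
  filter_upwards [ae_margCdf_ne hcont r.1.1 (x r.1.1), ae_margCdf_ne hcont r.1.2 (x r.1.2)]
    with y h1 h2
  have key : ∀ j, margCdf ν j (y j) ≠ margCdf ν j (x j) →
      (margCdf ν j (y j) ≤ margCdf ν j (x j) ↔ y j < x j) := fun j hj =>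
    ⟨fun h => (margCdf_mono j).reflect_lt (lt_of_le_of_ne h hj), fun h => margCdf_mono j h.le⟩
  exact propext (and_congr (key _ h1) (key _ h2))

theorem copS_margCdf (hcont : ∀ j, Continuous (margCdf ν j)) (r : Pos d) (x : Fin d → ℝ) :
    copS ν r (fun j => margCdf ν j (x j)) = ∫ y, lower r x y ∂ν := by
  have hm : MeasurableSet {v : Fin d → ℝ | margCdf ν r.1.1 (x r.1.1) < v r.1.1 ∧
      margCdf ν r.1.2 (x r.1.2) < v r.1.2} :=
    measurableSet_lt_and_lt (by fun_prop) (by fun_prop) (by fun_prop) (by fun_prop)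
  have hs : MeasurableSet {y : Fin d → ℝ | x r.1.1 < y r.1.1 ∧ x r.1.2 < y r.1.2} :=
    measurableSet_lt_and_lt (by fun_prop) (by fun_prop) (by fun_prop) (by fun_prop)
  have hl : (fun y => lower r x y)
      = {y : Fin d → ℝ | x r.1.1 < y r.1.1 ∧ x r.1.2 < y r.1.2}.indicator 1 := by
    funext y; simp [lower, Set.indicator_apply]
  rw [hl, integral_indicator_one hs, copS, copulaLaw,
    map_measureReal_apply measurable_margCdf hm]
  refine measureReal_congr ?_
  filter_upwards [ae_margCdf_ne hcont r.1.1 (x r.1.1), ae_margCdf_ne hcont r.1.2 (x r.1.2)]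
    with y h1 h2
  have key : ∀ j, margCdf ν j (y j) ≠ margCdf ν j (x j) →
      (margCdf ν j (x j) < margCdf ν j (y j) ↔ x j < y j) := fun j hj =>
    ⟨fun h => (margCdf_mono j).reflect_lt h,
      fun h => lt_of_le_of_ne (margCdf_mono j h.le) hj.symm⟩
  exact propext (and_congr (key _ h1) (key _ h2))

/-- The distribution function of the `(i, j)` marginal of the copula, for arbitrary `i` and `j`. -/
def copCIdx (ν : Measure (Fin d → ℝ)) (i j : Fin d) (u : Fin d → ℝ) : ℝ :=
  (copulaLaw ν).real {v | v i ≤ u i ∧ v j ≤ u j}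

/-- The survival function of the `(i, j)` marginal of the copula, for arbitrary `i` and `j`. -/
def copSIdx (ν : Measure (Fin d → ℝ)) (i j : Fin d) (u : Fin d → ℝ) : ℝ :=
  (copulaLaw ν).real {v | u i < v i ∧ u j < v j}

theorem measurable_copCIdx (i j : Fin d) : Measurable (copCIdx ν i j) := by
  have hs : MeasurableSet {p : (Fin d → ℝ) × (Fin d → ℝ) | p.2 i ≤ p.1 i ∧ p.2 j ≤ p.1 j} :=
    measurableSet_le_and_le (by fun_prop) (by fun_prop) (by fun_prop) (by fun_prop)
  exact (measurable_measure_prodMk_left (ν := copulaLaw ν) hs).ennreal_toReal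

theorem measurable_copSIdx (i j : Fin d) : Measurable (copSIdx ν i j) := by
  have hs : MeasurableSet {p : (Fin d → ℝ) × (Fin d → ℝ) | p.1 i < p.2 i ∧ p.1 j < p.2 j} :=
    measurableSet_lt_and_lt (by fun_prop) (by fun_prop) (by fun_prop) (by fun_prop)
  exact (measurable_measure_prodMk_left (ν := copulaLaw ν) hs).ennreal_toReal

theorem measurable_copC (r : Pos d) : Measurable (copC ν r) := measurable_copCIdx _ _

theorem measurable_copS (r : Pos d) : Measurable (copS ν r) := measurable_copSIdx _ _

theorem thetaSum_eq_integral_lower (hcont : ∀ j, Continuous (margCdf ν j)) (r s : Pos d) :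
    thetaSum ν r s = (∫ x, (∫ y, lower r y x ∂ν) * (∫ z, lower s z x ∂ν) ∂ν)
      + (∫ x, (∫ y, lower r x y ∂ν) * (∫ z, lower s z x ∂ν) ∂ν)
      + (∫ x, (∫ y, lower r y x ∂ν) * (∫ z, lower s x z ∂ν) ∂ν)
      + ∫ x, (∫ y, lower r x y ∂ν) * (∫ z, lower s x z ∂ν) ∂ν := by
  unfold thetaSum
  rw [integral_copulaLaw (f := fun u => copC ν r u * copC ν s u)
      ((measurable_copC r).mul (measurable_copC s)),
    integral_copulaLaw (f := fun u => copS ν r u * copC ν s u)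
      ((measurable_copS r).mul (measurable_copC s)),
    integral_copulaLaw (f := fun u => copC ν r u * copS ν s u)
      ((measurable_copC r).mul (measurable_copS s)),
    integral_copulaLaw (f := fun u => copS ν r u * copS ν s u)
      ((measurable_copS r).mul (measurable_copS s))]
  simp only [copC_margCdf hcont, copS_margCdf hcont]

theorem ae_prod_ne (hcont : ∀ j, Continuous (margCdf ν j)) (j : Fin d) :
    ∀ᵐ z ∂(ν.prod ν), z.1 j ≠ z.2 j := by
  have hm : MeasurableSet {z : (Fin d → ℝ) × (Fin d → ℝ) | z.1 j = z.2 j} :=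
    measurableSet_eq_fun (by fun_prop) (by fun_prop)
  rw [ae_iff]
  simp only [ne_eq, not_not]
  rw [Measure.measure_prod_null hm]
  refine ae_of_all _ fun x => ?_
  refine measure_mono_null ?_ (ae_iff.1 (ae_margCdf_ne hcont j (x j)))
  intro y hy
  have hy' : x j = y j := hy
  simp [hy']

/-- Without ties, `τ = 4 p - 1`, where `p` is the probability that the first of two independent
copies lies below the second one in both coordinates. -/
theorem tau_eq (hcont : ∀ j, Continuous (margCdf ν j)) (r : Pos d) :
    tau ν r = -1 + 4 * (ν.prod ν).real
      {z | z.1 r.1.1 ≤ z.2 r.1.1 ∧ z.1 r.1.2 ≤ z.2 r.1.2} := by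
  set A : Set ((Fin d → ℝ) × (Fin d → ℝ)) :=
    {z | z.1 r.1.1 < z.2 r.1.1 ∧ z.1 r.1.2 < z.2 r.1.2} with hA
  have hAm : MeasurableSet A := measurableSet_lower r
  have hA'm : MeasurableSet (Prod.swap ⁻¹' A) := measurable_swap hAm
  have hties : ∀ᵐ z ∂(ν.prod ν), z.1 r.1.1 ≠ z.2 r.1.1 ∧ z.1 r.1.2 ≠ z.2 r.1.2 :=
    (ae_prod_ne hcont r.1.1).and (ae_prod_ne hcont r.1.2)
  have hle : (ν.prod ν).real {z | z.1 r.1.1 ≤ z.2 r.1.1 ∧ z.1 r.1.2 ≤ z.2 r.1.2}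
      = (ν.prod ν).real A := by
    refine measureReal_congr ?_
    filter_upwards [hties] with z hz
    exact propext (and_congr ⟨fun h => lt_of_le_of_ne h hz.1, le_of_lt⟩
      ⟨fun h => lt_of_le_of_ne h hz.2, le_of_lt⟩)
  have hswap : (ν.prod ν).real (Prod.swap ⁻¹' A) = (ν.prod ν).real A := by
    rw [← map_measureReal_apply measurable_swap hAm, Measure.prod_swap]
  have hdisj : Disjoint A (Prod.swap ⁻¹' A) := by
    rw [Set.disjoint_left]
    intro z hz hz'
    exact lt_asymm hz.1 hz'.1
  have hconc : (ν.prod ν).real {z | 0 < (z.1 r.1.1 - z.2 r.1.1) * (z.1 r.1.2 - z.2 r.1.2)}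
      = 2 * (ν.prod ν).real A := by
    have : {z : (Fin d → ℝ) × (Fin d → ℝ) |
        0 < (z.1 r.1.1 - z.2 r.1.1) * (z.1 r.1.2 - z.2 r.1.2)} = A ∪ Prod.swap ⁻¹' A := by
      ext z
      simp only [Set.mem_ofPred_eq, mul_pos_iff, sub_pos, sub_neg, hA, Set.mem_union,
        Set.mem_preimage, Prod.fst_swap, Prod.snd_swap]
      tauto
    rw [this, measureReal_union hdisj hA'm, hswap, two_mul]
  have hdisc : (ν.prod ν).real {z | (z.1 r.1.1 - z.2 r.1.1) * (z.1 r.1.2 - z.2 r.1.2) < 0}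
      = 1 - 2 * (ν.prod ν).real A := by
    have hcm : MeasurableSet {z : (Fin d → ℝ) × (Fin d → ℝ) |
        0 < (z.1 r.1.1 - z.2 r.1.1) * (z.1 r.1.2 - z.2 r.1.2)} :=
      measurableSet_lt (by fun_prop) (by fun_prop)
    rw [← hconc, ← probReal_compl_eq_one_sub hcm]
    refine measureReal_congr ?_
    filter_upwards [hties] with z hz
    have hne : (z.1 r.1.1 - z.2 r.1.1) * (z.1 r.1.2 - z.2 r.1.2) ≠ 0 :=
      mul_ne_zero (sub_ne_zero.2 hz.1) (sub_ne_zero.2 hz.2)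
    exact propext ⟨fun h => not_lt.2 (le_of_lt h), fun h => lt_of_le_of_ne (not_lt.1 h) hne⟩
  rw [tau, hconc, hdisc, hle]
  ring

end Copula

/-! ### Consistency of the estimators -/

section Consistency

theorem tendsto_natCast_div_sub_one : Tendsto (fun n : ℕ => (n : ℝ) / (n - 1)) atTop (𝓝 1) := by
  simpa [sub_eq_add_neg] using tendsto_natCast_div_add_atTop (-1 : ℝ)

theorem sum_fin_two_arrow {α : Type*} [Fintype α] [DecidableEq α] (f : α → α → ℝ)
    [DecidablePred fun t : Fin 2 → α => Function.Injective t] :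
    ∑ t : Fin 2 → α, (if Function.Injective t then f (t 0) (t 1) else 0)
      = ∑ a, ∑ b, if a ≠ b then f a b else 0 := by
  rw [← Fintype.sum_prod_type']
  refine Fintype.sum_equiv (finTwoArrowEquiv α) _ _ fun t => ?_
  have : Function.Injective t ↔ t 0 ≠ t 1 := by
    constructor
    · intro h e; exact absurd (h e) (by decide)
    · intro h i j e
      fin_cases i <;> fin_cases j <;> simp_all
  simp [this, finTwoArrowEquiv]

theorem sum_fin_three_arrow {α : Type*} [Fintype α] [DecidableEq α] (f : α → α → α → ℝ)
    [DecidablePred fun t : Fin 3 → α => Function.Injective t] :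
    ∑ t : Fin 3 → α, (if Function.Injective t then f (t 0) (t 1) (t 2) else 0)
      = ∑ a, ∑ b, ∑ c, if a ≠ b ∧ b ≠ c ∧ a ≠ c then f a b c else 0 := by
  let e : (Fin 3 → α) ≃ α × α × α :=
    { toFun := fun t => (t 0, t 1, t 2)
      invFun := fun p => ![p.1, p.2.1, p.2.2]
      left_inv := fun t => by funext i; fin_cases i <;> rfl
      right_inv := fun p => rfl }
  rw [Fintype.sum_equiv e _ (fun p : α × α × α =>
    if p.1 ≠ p.2.1 ∧ p.2.1 ≠ p.2.2 ∧ p.1 ≠ p.2.2 then f p.1 p.2.1 p.2.2 else 0) fun t => ?_]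
  · simp only [Fintype.sum_prod_type]
  · have : Function.Injective t ↔ t 0 ≠ t 1 ∧ t 1 ≠ t 2 ∧ t 0 ≠ t 2 := by
      constructor
      · intro h
        exact ⟨h.ne (by decide), h.ne (by decide), h.ne (by decide)⟩
      · rintro ⟨h1, h2, h3⟩ i j e
        fin_cases i <;> fin_cases j <;> simp_all
    simp only [this]
    rfl

variable {d : ℕ} {ν : Measure (Fin d → ℝ)} [IsProbabilityMeasure ν]
  {Ω : Type*} [MeasurableSpace Ω] {μ : Measure Ω} [IsProbabilityMeasure μ]
  {X : ℕ → Ω → Fin d → ℝ}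

/-- Conditionally on one observation, the two others are independent. -/
theorem integral_mul_eq_integral_mul_integral (hlaw : ∀ k, HasLaw (X k) ν μ)
    (hindep : iIndepFun X μ) {a b c : ℕ} (hab : a ≠ b) (hac : a ≠ c) (hcb : c ≠ b)
    {f g : (Fin d → ℝ) → (Fin d → ℝ) → ℝ}
    (hf : Measurable fun z : (Fin d → ℝ) × (Fin d → ℝ) => f z.1 z.2)
    (hg : Measurable fun z : (Fin d → ℝ) × (Fin d → ℝ) => g z.1 z.2)
    (hf1 : ∀ x y, |f x y| ≤ 1) (hg1 : ∀ x y, |g x y| ≤ 1) :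
    ∫ ω, f (X a ω) (X b ω) * g (X c ω) (X b ω) ∂μ
      = ∫ y, (∫ x, f x y ∂ν) * (∫ z, g z y ∂ν) ∂ν := by
  have hX : ∀ k, AEMeasurable (X k) μ := fun k => (hlaw k).aemeasurable
  have hl : HasLaw (fun ω => ((X a ω, X c ω), X b ω)) ((ν.prod ν).prod ν) μ :=
    IndepFun.hasLaw_prod (IndepFun.hasLaw_prod (hlaw a) (hlaw c) (hindep.indepFun hac)) (hlaw b)
      (hindep.indepFun_prodMk₀ hX a c b hab hcb)
  have hm : Measurable fun p : ((Fin d → ℝ) × (Fin d → ℝ)) × (Fin d → ℝ) =>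
      f p.1.1 p.2 * g p.1.2 p.2 :=
    (hf.comp ((measurable_fst.comp measurable_fst).prodMk measurable_snd)).mul
      (hg.comp ((measurable_snd.comp measurable_fst).prodMk measurable_snd))
  have h1 := hl.integral_comp hm.aestronglyMeasurable
  refine h1.trans ?_
  rw [integral_prod_symm]
  · refine integral_congr_ae (ae_of_all _ fun y => ?_)
    exact integral_prod_mul (fun x => f x y) (fun z => g z y)
  · refine Integrable.of_bound hm.aestronglyMeasurable 1 (ae_of_all _ fun p => ?_)
    rw [Real.norm_eq_abs, abs_mul]
    exact mul_le_one₀ (hf1 _ _) (abs_nonneg _) (hg1 _ _)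

theorem tendsto_tauHat (hcont : ∀ j, Continuous (margCdf ν j)) (hlaw : ∀ k, HasLaw (X k) ν μ)
    (hindep : iIndepFun X μ) :
    Tendsto (fun p : ℕ × Ω => tauHat (fun k : Fin p.1 => X k p.2)) (inProb μ) (𝓝 (tau ν)) := by
  classical
  refine tendsto_pi_nhds.2 fun r => ?_
  have hS : MeasurableSet {z : (Fin d → ℝ) × (Fin d → ℝ) |
      z.1 r.1.1 ≤ z.2 r.1.1 ∧ z.1 r.1.2 ≤ z.2 r.1.2} :=
    measurableSet_le_and_le (by fun_prop) (by fun_prop) (by fun_prop) (by fun_prop)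
  let k : (Fin d → ℝ) → (Fin d → ℝ) → ℝ := fun x y =>
    if x r.1.1 ≤ y r.1.1 ∧ x r.1.2 ≤ y r.1.2 then 1 else 0
  have hk : Measurable fun z : (Fin d → ℝ) × (Fin d → ℝ) => k z.1 z.2 :=
    Measurable.ite hS measurable_const measurable_const
  have hind : (fun z : (Fin d → ℝ) × (Fin d → ℝ) => k z.1 z.2) = Set.indicator
      {z | z.1 r.1.1 ≤ z.2 r.1.1 ∧ z.1 r.1.2 ≤ z.2 r.1.2} 1 := by
    funext z; simp [k, Set.indicator_apply]
  have hU := tendsto_uStat_inProb (κ := Fin 2) (fun k => (hlaw k).aemeasurable) hindep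
    (h := fun z => k (z 0) (z 1)) (C := 1)
    (θ := (ν.prod ν).real {z | z.1 r.1.1 ≤ z.2 r.1.1 ∧ z.1 r.1.2 ≤ z.2 r.1.2})
    (hk.comp (f := fun z : Fin 2 → Fin d → ℝ => (z 0, z 1))
      ((measurable_pi_apply 0).prodMk (measurable_pi_apply 1)))
    (fun z => by simp only [k]; split_ifs <;> simp) (fun t ht => by
      have hl := IndepFun.hasLaw_prod (hlaw (t 0)) (hlaw (t 1)) (hindep.indepFun (ht.ne (by decide)))
      refine (hl.integral_comp hk.aestronglyMeasurable).trans ?_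
      rw [hind, integral_indicator_one hS])
  rw [tau_eq hcont]
  have hρ := tendsto_natCast_div_sub_one.comp (tendsto_fst_inProb μ)
  have hlim := ((hρ.mul hU).const_mul 4).const_add (-1)
  rw [one_mul] at hlim
  refine hlim.congr' ?_
  filter_upwards [(tendsto_fst_inProb μ).eventually (eventually_gt_atTop 1)] with p hp
  have h1 : (1 : ℝ) < p.1 := by exact_mod_cast hp
  have h0 : (p.1 : ℝ) ≠ 0 := by positivity
  have h2 : (p.1 : ℝ) - 1 ≠ 0 := by linarith
  rw [tauHat]
  have hsum := sum_fin_two_arrow (fun a b : Fin p.1 => k (X a p.2) (X b p.2))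
  simp only [Function.comp_apply]
  rw [hsum]
  have : ∀ a b : Fin p.1, (if a ≠ b then k (X a p.2) (X b p.2) else 0)
      = if a ≠ b ∧ X a p.2 r.1.1 ≤ X b p.2 r.1.1 ∧ X a p.2 r.1.2 ≤ X b p.2 r.1.2 then 1 else 0 := by
    intro a b
    simp only [k, ite_and]
  simp only [this, Fintype.card_fin]
  field_simp

/-- The kernel of the U-statistic `θ̂₁ + θ̂₂ + θ̂₃ + θ̂₄`. -/
def thetaKernel (r s : Pos d) (x y z : Fin d → ℝ) : ℝ :=
  lower r x y * lower s z y + lower r x y * lower s z x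
    + lower r x y * lower s y z + lower r x y * lower s x z

theorem integral_thetaKernel (hcont : ∀ j, Continuous (margCdf ν j))
    (hlaw : ∀ k, HasLaw (X k) ν μ) (hindep : iIndepFun X μ) (r s : Pos d) {a b c : ℕ}
    (hab : a ≠ b) (hbc : b ≠ c) (hac : a ≠ c) :
    ∫ ω, thetaKernel r s (X a ω) (X b ω) (X c ω) ∂μ = thetaSum ν r s := by
  have hr := measurable_lower r
  have hs := measurable_lower s
  have hr' := hr.comp measurable_swap
  have hs' := hs.comp measurable_swap
  have br := abs_lower_le_one r
  have bs := abs_lower_le_one s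
  have hint : ∀ (i j k l : ℕ),
      Integrable (fun ω => lower r (X i ω) (X j ω) * lower s (X k ω) (X l ω)) μ := by
    intro i j k l
    have hX : ∀ k, AEMeasurable (X k) μ := fun k => (hlaw k).aemeasurable
    refine Integrable.of_bound ((hr.comp_aemeasurable ((hX i).prodMk (hX j))).mul
      (hs.comp_aemeasurable ((hX k).prodMk (hX l)))).aestronglyMeasurable 1
      (ae_of_all _ fun p => ?_)
    rw [Real.norm_eq_abs, abs_mul]
    exact mul_le_one₀ (br _ _) (abs_nonneg _) (bs _ _)
  have e1 := integral_mul_eq_integral_mul_integral hlaw hindep hab hac hbc.symm hr hs br bs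
  have e2 := integral_mul_eq_integral_mul_integral hlaw hindep hab.symm hbc hac.symm
    (f := fun x y => lower r y x) hr' hs (fun x y => br y x) bs
  have e3 := integral_mul_eq_integral_mul_integral hlaw hindep hab hac hbc.symm
    (g := fun x y => lower s y x) hr hs' br (fun x y => bs y x)
  have e4 := integral_mul_eq_integral_mul_integral hlaw hindep hab.symm hbc hac.symm
    (f := fun x y => lower r y x) (g := fun x y => lower s y x) hr' hs'
    (fun x y => br y x) (fun x y => bs y x)
  unfold thetaKernel
  rw [integral_add (by fun_prop) (by fun_prop), integral_add (by fun_prop) (by fun_prop),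
    integral_add (by fun_prop) (by fun_prop), e1, e2, e3, e4, thetaSum_eq_integral_lower hcont]

theorem measurable_thetaKernel (r s : Pos d) :
    Measurable fun z : Fin 3 → Fin d → ℝ => thetaKernel r s (z 0) (z 1) (z 2) := by
  have h : ∀ (q : Pos d) (i j : Fin 3),
      Measurable fun z : Fin 3 → Fin d → ℝ => lower q (z i) (z j) := fun q i j =>
    (measurable_lower q).comp (f := fun z : Fin 3 → Fin d → ℝ => (z i, z j))
      ((measurable_pi_apply i).prodMk (measurable_pi_apply j))
  exact ((((h r 0 1).mul (h s 2 1)).add ((h r 0 1).mul (h s 2 0))).add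
    ((h r 0 1).mul (h s 1 2))).add ((h r 0 1).mul (h s 0 2))

theorem abs_thetaKernel_le (r s : Pos d) (x y z : Fin d → ℝ) : |thetaKernel r s x y z| ≤ 4 := by
  have h : ∀ x y x' y', 0 ≤ lower r x y * lower s x' y' ∧ lower r x y * lower s x' y' ≤ 1 :=
    fun x y x' y' => ⟨mul_nonneg (lower_nonneg r _ _) (lower_nonneg s _ _),
      mul_le_one₀ (lower_le_one r _ _) (lower_nonneg s _ _) (lower_le_one s _ _)⟩
  rw [abs_le, thetaKernel]
  constructor <;> linarith [h x y z y, h x y z x, h x y y z, h x y x z]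

/-- `n Θ̂ → 16 (θ₁ + θ₂ + θ₃ + θ₄)` in probability: the sum over triples is a U-statistic of order
three, and the sum over pairs is of smaller order. -/
theorem tendsto_ThetaHat (hcont : ∀ j, Continuous (margCdf ν j)) (hlaw : ∀ k, HasLaw (X k) ν μ)
    (hindep : iIndepFun X μ) (r s : Pos d) :
    Tendsto (fun p : ℕ × Ω => (p.1 : ℝ) * ThetaHat (fun k : Fin p.1 => X k p.2) r s)
      (inProb μ) (𝓝 (16 * thetaSum ν r s)) := by
  classical
  have hU := tendsto_uStat_inProb (κ := Fin 3) (fun k => (hlaw k).aemeasurable) hindep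
    (h := fun z => thetaKernel r s (z 0) (z 1) (z 2)) (C := 4) (θ := thetaSum ν r s)
    (measurable_thetaKernel r s) (fun z => abs_thetaKernel_le r s _ _ _)
    (fun t ht => integral_thetaKernel hcont hlaw hindep r s (ht.ne (by decide))
      (ht.ne (by decide)) (ht.ne (by decide)))
  let S₂ : ℕ × Ω → ℝ := fun p => ∑ a : Fin p.1, ∑ b : Fin p.1, if a ≠ b then
    lower r (X a p.2) (X b p.2) * lower s (X a p.2) (X b p.2)
      + lower r (X a p.2) (X b p.2) * lower s (X b p.2) (X a p.2) else 0
  have hS₂ : ∀ p, |S₂ p / (p.1 : ℝ) ^ 2| ≤ 2 := by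
    intro p
    rw [abs_div, abs_of_nonneg (by positivity : (0 : ℝ) ≤ (p.1 : ℝ) ^ 2)]
    refine div_le_of_le_mul₀ (by positivity) (by norm_num) ?_
    calc |S₂ p| ≤ ∑ a : Fin p.1, ∑ b : Fin p.1, (2 : ℝ) := by
          refine (Finset.abs_sum_le_sum_abs _ _).trans (Finset.sum_le_sum fun a _ => ?_)
          refine (Finset.abs_sum_le_sum_abs _ _).trans (Finset.sum_le_sum fun b _ => ?_)
          have h : ∀ x y x' y', |lower r x y * lower s x' y'| ≤ 1 := fun x y x' y' => by
            rw [abs_mul]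
            exact mul_le_one₀ (abs_lower_le_one r _ _) (abs_nonneg _) (abs_lower_le_one s _ _)
          split_ifs
          · refine (abs_add_le _ _).trans ?_
            linarith [h (X a p.2) (X b p.2) (X a p.2) (X b p.2),
              h (X a p.2) (X b p.2) (X b p.2) (X a p.2)]
          · simp
      _ = 2 * (p.1 : ℝ) ^ 2 := by simp; ring
  have hρ := tendsto_natCast_div_sub_one.comp (tendsto_fst_inProb μ)
  have hinv : Tendsto (fun p : ℕ × Ω => ((p.1 : ℝ))⁻¹) (inProb μ) (𝓝 0) :=
    tendsto_inv_atTop_nhds_zero_nat.comp (tendsto_fst_inProb μ)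
  have h2 : Tendsto (fun p : ℕ × Ω => (p.1 : ℝ)⁻¹ * (S₂ p / (p.1 : ℝ) ^ 2)) (inProb μ) (𝓝 0) := by
    refine squeeze_zero_norm (a := fun p : ℕ × Ω => (p.1 : ℝ)⁻¹ * 2) (fun p => ?_)
      (by simpa using hinv.mul_const 2)
    rw [norm_mul, Real.norm_of_nonneg (by positivity)]
    exact mul_le_mul_of_nonneg_left (hS₂ p) (by positivity)
  have hlim := ((hρ.pow 2).mul (hU.add h2)).const_mul 16
  rw [one_pow, one_mul, add_zero] at hlim
  refine hlim.congr' ?_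
  filter_upwards [(tendsto_fst_inProb μ).eventually (eventually_gt_atTop 2)] with p hp
  have h1 : (2 : ℝ) < p.1 := by exact_mod_cast hp
  have h0 : (p.1 : ℝ) ≠ 0 := by positivity
  have h2 : (p.1 : ℝ) - 1 ≠ 0 := by linarith
  have h3 : (p.1 : ℝ) - 2 ≠ 0 := by linarith
  have hsum := sum_fin_three_arrow
    (fun a b c : Fin p.1 => thetaKernel r s (X a p.2) (X b p.2) (X c p.2))
  rw [hsum]
  have hθ : (p.1 : ℝ) * (p.1 - 1) * (p.1 - 2) * thetaSumHat (fun k : Fin p.1 => X k p.2) r s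
      = ∑ a : Fin p.1, ∑ b : Fin p.1, ∑ c : Fin p.1, if a ≠ b ∧ b ≠ c ∧ a ≠ c then
          thetaKernel r s (X a p.2) (X b p.2) (X c p.2) else 0 := by
    rw [thetaSumHat, ← mul_assoc, mul_one_div_cancel (by positivity), one_mul]
    rfl
  have hϑ : (p.1 : ℝ) * (p.1 - 1) * varthetaSumHat (fun k : Fin p.1 => X k p.2) r s = S₂ p := by
    rw [varthetaSumHat, ← mul_assoc, mul_one_div_cancel (by positivity), one_mul]
    rfl
  rw [ThetaHat, Matrix.of_apply, hθ, hϑ]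
  simp only [Function.comp_apply, Fintype.card_fin]
  field_simp
  ring

end Consistency

/-! ### Orbits of pairs of positions -/

section Orbits

variable {d : ℕ}

/-- Two injective tuples with the same colours are related by an element of any permutation group
that contains all transpositions of points of the same colour. -/
theorem exists_mem_apply_eq {m : ℕ} {β : Type*} {N : Subgroup (Equiv.Perm (Fin d))} {c : Fin d → β}
    (hN : ∀ a b, c a = c b → Equiv.swap a b ∈ N) {e e' : Fin m → Fin d}
    (he : Function.Injective e) (he' : Function.Injective e') (hc : ∀ a, c (e a) = c (e' a)) :
    ∃ π ∈ N, ∀ a, π (e a) = e' a := by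
  obtain ⟨π, hπN, -, hπ⟩ := exists_mem_eqOn N c hN (Finset.univ.image e) (Function.extend e e' id)
    (by
      intro x hx y hy hxy
      simp only [Finset.coe_image, Finset.coe_univ, Set.image_univ, Set.mem_range] at hx hy
      obtain ⟨a, rfl⟩ := hx
      obtain ⟨b, rfl⟩ := hy
      rw [he.extend_apply, he.extend_apply] at hxy
      rw [he' hxy])
    (by
      intro x hx
      obtain ⟨a, -, rfl⟩ := Finset.mem_image.1 hx
      rw [he.extend_apply, hc])
  refine ⟨π, hπN, fun a => ?_⟩
  rw [hπ _ (Finset.mem_image_of_mem e (Finset.mem_univ a)), he.extend_apply]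

theorem injective_vec_two {α : Type*} {x y : α} (h : x ≠ y) : Function.Injective ![x, y] := by
  intro a b hab
  fin_cases a <;> fin_cases b <;> simp_all

theorem injective_vec_three {α : Type*} {x y z : α} (h₁ : x ≠ y) (h₂ : x ≠ z) (h₃ : y ≠ z) :
    Function.Injective ![x, y, z] := by
  intro a b hab
  fin_cases a <;> fin_cases b <;> simp_all

theorem injective_vec_four_iff {α : Type*} {i j k l : α} : Function.Injective ![i, j, k, l] ↔
    i ≠ j ∧ i ≠ k ∧ i ≠ l ∧ j ≠ k ∧ j ≠ l ∧ k ≠ l := by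
  constructor
  · intro h
    exact ⟨h.ne (a₁ := 0) (a₂ := 1) (by decide), h.ne (a₁ := 0) (a₂ := 2) (by decide),
      h.ne (a₁ := 0) (a₂ := 3) (by decide), h.ne (a₁ := 1) (a₂ := 2) (by decide),
      h.ne (a₁ := 1) (a₂ := 3) (by decide), h.ne (a₁ := 2) (a₂ := 3) (by decide)⟩
  · rintro ⟨h1, h2, h3, h4, h5, h6⟩ a b h
    fin_cases a <;> fin_cases b <;> simp_all

/-- The edges `{i, j}` and `{k, l}` share no vertex, one vertex or two vertices; a shared vertex can
be brought to the front of both edges by the symmetries of `Φ`. -/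
theorem overlap_cases {β : Type*} (c : Fin d → β) (Φ : Fin d → Fin d → Fin d → Fin d → ℝ)
    (hswap : ∀ i j k l, Φ j i k l = Φ i j k l) (hcomm : ∀ i j k l, Φ k l i j = Φ i j k l)
    {i j k l : Fin d} (hij : i ≠ j) (hkl : k ≠ l) :
    (Function.Injective ![i, j, k, l] ∧
      (({i, j} : Finset (Fin d)) ∩ {k, l}).val.map c = 0) ∨
    (∃ x y z, Function.Injective ![x, y, z] ∧ Φ i j k l = Φ x y x z ∧ s(c i, c j) = s(c x, c y) ∧
      s(c k, c l) = s(c x, c z) ∧ (({i, j} : Finset (Fin d)) ∩ {k, l}).val.map c = {c x}) ∨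
    (Φ i j k l = Φ i j i j ∧
      ((({i, j} : Finset (Fin d)) ∩ {k, l}).val.map c).card = 2) := by
  have hswap' : ∀ i j k l, Φ i j l k = Φ i j k l := fun i j k l => by
    rw [← hcomm, hswap, hcomm]
  have hone : ∀ x : Fin d, ({i, j} : Finset (Fin d)) ∩ {k, l} = {x} →
      (({i, j} : Finset (Fin d)) ∩ {k, l}).val.map c = {c x} := by
    intro x h
    rw [h]; simp
  have htwo : ({i, j} : Finset (Fin d)) ∩ {k, l} = {i, j} →
      ((({i, j} : Finset (Fin d)) ∩ {k, l}).val.map c).card = 2 := by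
    intro h
    rw [h, Multiset.card_map]
    exact Finset.card_pair hij
  by_cases hik : i = k
  · subst hik
    by_cases hjl : j = l
    · subst hjl
      exact Or.inr (Or.inr ⟨rfl, htwo (by simp)⟩)
    · exact Or.inr (Or.inl ⟨i, j, l, injective_vec_three hij hkl hjl, rfl, rfl, rfl,
        hone i (by ext x; simp; grind)⟩)
  by_cases hjl : j = l
  · subst hjl
    exact Or.inr (Or.inl ⟨j, i, k, injective_vec_three hij.symm hkl.symm hik, by rw [hswap, hswap'],
      Sym2.eq_swap, Sym2.eq_swap, hone j (by ext x; simp; grind)⟩)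
  by_cases hil : i = l
  · subst hil
    by_cases hjk : j = k
    · subst hjk
      exact Or.inr (Or.inr ⟨hswap' _ _ _ _, htwo (by ext x; simp; grind)⟩)
    · exact Or.inr (Or.inl ⟨i, j, k, injective_vec_three hij hik hjk, hswap' _ _ _ _, rfl,
        Sym2.eq_swap, hone i (by ext x; simp; grind)⟩)
  by_cases hjk : j = k
  · subst hjk
    exact Or.inr (Or.inl ⟨j, i, l, injective_vec_three hij.symm hkl hil, hswap _ _ _ _,
      Sym2.eq_swap, rfl, hone j (by ext x; simp; grind)⟩)
  refine Or.inl ⟨?_, ?_⟩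
  · exact injective_vec_four_iff.2 ⟨hij, hik, hil, hjk, hjl, hkl⟩
  · have : ({i, j} : Finset (Fin d)) ∩ {k, l} = ∅ := by ext x; simp; grind
    rw [this]; simp

/-- The pair of blocks and the overlap determine the orbit of a pair of positions under the
permutations that preserve the clusters. -/
theorem eq_of_block_eq_of_overlap_eq (G : IdxPartition d) {N : Subgroup (Equiv.Perm (Fin d))}
    (hN : ∀ a b, G.part a = G.part b → Equiv.swap a b ∈ N)
    (Φ : Fin d → Fin d → Fin d → Fin d → ℝ)
    (hswap : ∀ i j k l, Φ j i k l = Φ i j k l) (hcomm : ∀ i j k l, Φ k l i j = Φ i j k l)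
    (hperm : ∀ π ∈ N, ∀ i j k l, Φ (π i) (π j) (π k) (π l) = Φ i j k l)
    {r s r' s' : Pos d} (hr : block G r = block G r') (hs : block G s = block G s')
    (ho : overlap G r s = overlap G r' s') :
    Φ r.1.1 r.1.2 s.1.1 s.1.2 = Φ r'.1.1 r'.1.2 s'.1.1 s'.1.2 := by
  have hswap' : ∀ i j k l, Φ i j l k = Φ i j k l := fun i j k l => by
    rw [← hcomm, hswap, hcomm]
  unfold block at hr hs
  unfold overlap at ho
  have move4 : ∀ i j k l i' j' k' l' : Fin d, Function.Injective ![i, j, k, l] →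
      Function.Injective ![i', j', k', l'] → G.part i = G.part i' → G.part j = G.part j' →
      G.part k = G.part k' → G.part l = G.part l' → Φ i j k l = Φ i' j' k' l' := by
    intro i j k l i' j' k' l' h h' h1 h2 h3 h4
    obtain ⟨π, hπ, he⟩ := exists_mem_apply_eq hN h h'
      (fun a => by fin_cases a <;> simp [h1, h2, h3, h4])
    rw [← hperm π hπ, show π i = i' from he 0, show π j = j' from he 1, show π k = k' from he 2,
      show π l = l' from he 3]
  rcases overlap_cases G.part Φ hswap hcomm r.2.ne s.2.ne with
    ⟨h1, h2⟩ | ⟨x, y, z, h1, h2, h3, h4, h5⟩ | ⟨h1, h2⟩ <;>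
  rcases overlap_cases G.part Φ hswap hcomm r'.2.ne s'.2.ne with
    ⟨h1', h2'⟩ | ⟨x', y', z', h1', h2', h3', h4', h5'⟩ | ⟨h1', h2'⟩
  · have h1'' := injective_vec_four_iff.1 h1'
    rcases Sym2.eq_iff.1 hr with ⟨e1, e2⟩ | ⟨e1, e2⟩ <;>
    rcases Sym2.eq_iff.1 hs with ⟨e3, e4⟩ | ⟨e3, e4⟩
    · exact move4 _ _ _ _ _ _ _ _ h1 h1' e1 e2 e3 e4
    · rw [← hswap' r'.1.1]
      exact move4 _ _ _ _ _ _ _ _ h1 (injective_vec_four_iff.2 (by tauto)) e1 e2 e3 e4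
    · rw [← hswap r'.1.1]
      exact move4 _ _ _ _ _ _ _ _ h1 (injective_vec_four_iff.2 (by tauto)) e1 e2 e3 e4
    · rw [← hswap r'.1.1, ← hswap' r'.1.2]
      exact move4 _ _ _ _ _ _ _ _ h1 (injective_vec_four_iff.2 (by tauto)) e1 e2 e3 e4
  · rw [h2, h5'] at ho
    simpa using congrArg Multiset.card ho
  · rw [← ho, h2] at h2'
    simp at h2'
  · rw [h5, h2'] at ho
    simpa using congrArg Multiset.card ho
  · rw [h5, h5', Multiset.singleton_inj] at ho
    have hy : G.part y = G.part y' := by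
      have := h3.symm.trans (hr.trans h3')
      rw [ho] at this
      exact Sym2.congr_right.1 this
    have hz : G.part z = G.part z' := by
      have := h4.symm.trans (hs.trans h4')
      rw [ho] at this
      exact Sym2.congr_right.1 this
    obtain ⟨π, hπ, he⟩ := exists_mem_apply_eq hN h1 h1'
      (fun a => by fin_cases a <;> simp [ho, hy, hz])
    rw [h2, h2', ← hperm π hπ, show π x = x' from he 0, show π y = y' from he 1,
      show π z = z' from he 2]
  · rw [← ho, h5] at h2'
    simp at h2'
  · rw [ho, h2'] at h2
    simp at h2
  · rw [ho, h5'] at h2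
    simp at h2
  · rw [h1, h1']
    have move2 : ∀ i j i' j' : Fin d, i ≠ j → i' ≠ j' → G.part i = G.part i' →
        G.part j = G.part j' → Φ i j i j = Φ i' j' i' j' := by
      intro i j i' j' h h' e1 e2
      obtain ⟨π, hπ, he⟩ := exists_mem_apply_eq hN (injective_vec_two h)
        (injective_vec_two h')
        (fun a => by fin_cases a <;> simp [e1, e2])
      rw [← hperm π hπ, show π i = i' from he 0, show π j = j' from he 1]
    rcases Sym2.eq_iff.1 hr with ⟨e1, e2⟩ | ⟨e1, e2⟩
    · exact move2 _ _ _ _ r.2.ne r'.2.ne e1 e2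
    · rw [← hswap r'.1.1, ← hswap' r'.1.2]
      exact move2 _ _ _ _ r.2.ne r'.2.ne' e1 e2

end Orbits

/-! ### The limit of the structured covariance estimator -/

section Covariance

variable {d : ℕ} {ν : Measure (Fin d → ℝ)}

/-- The sum `θ₁ + θ₂ + θ₃ + θ₄` for pairs of indices that need not be increasing. -/
def thetaSumIdx (ν : Measure (Fin d → ℝ)) (i j k l : Fin d) : ℝ :=
  (∫ u, copCIdx ν i j u * copCIdx ν k l u ∂(copulaLaw ν))
    + (∫ u, copSIdx ν i j u * copCIdx ν k l u ∂(copulaLaw ν))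
    + (∫ u, copCIdx ν i j u * copSIdx ν k l u ∂(copulaLaw ν))
    + ∫ u, copSIdx ν i j u * copSIdx ν k l u ∂(copulaLaw ν)

theorem thetaSumIdx_swap (i j k l : Fin d) : thetaSumIdx ν j i k l = thetaSumIdx ν i j k l := by
  have hC : copCIdx ν j i = copCIdx ν i j := by
    funext u; simp only [copCIdx, and_comm]
  have hS : copSIdx ν j i = copSIdx ν i j := by
    funext u; simp only [copSIdx, and_comm]
  simp only [thetaSumIdx, hC, hS]

theorem thetaSumIdx_comm (i j k l : Fin d) : thetaSumIdx ν k l i j = thetaSumIdx ν i j k l := by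
  simp only [thetaSumIdx, mul_comm (copCIdx ν k l _), mul_comm (copSIdx ν k l _)]
  ring

variable [IsProbabilityMeasure ν]

theorem thetaSumIdx_perm {π : Equiv.Perm (Fin d)} (hπ : π ∈ exchGroup (copulaLaw ν))
    (i j k l : Fin d) : thetaSumIdx ν (π i) (π j) (π k) (π l) = thetaSumIdx ν i j k l := by
  have hT : Measurable fun (u : Fin d → ℝ) a => u (π a) := by fun_prop
  have hπ' := mem_exchGroup.1 hπ
  have hC : ∀ i j u, copCIdx ν (π i) (π j) u = copCIdx ν i j (fun a => u (π a)) := by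
    intro i j u
    have hm : MeasurableSet {v : Fin d → ℝ | v i ≤ u (π i) ∧ v j ≤ u (π j)} :=
      measurableSet_le_and_le (by fun_prop) (by fun_prop) (by fun_prop) (by fun_prop)
    have h := map_measureReal_apply (μ := copulaLaw ν) hT hm
    rw [hπ'] at h
    exact h.symm
  have hS : ∀ i j u, copSIdx ν (π i) (π j) u = copSIdx ν i j (fun a => u (π a)) := by
    intro i j u
    have hm : MeasurableSet {v : Fin d → ℝ | u (π i) < v i ∧ u (π j) < v j} :=
      measurableSet_lt_and_lt (by fun_prop) (by fun_prop) (by fun_prop) (by fun_prop)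
    have h := map_measureReal_apply (μ := copulaLaw ν) hT hm
    rw [hπ'] at h
    exact h.symm
  have hint : ∀ f : (Fin d → ℝ) → ℝ, Measurable f →
      ∫ u, f (fun a => u (π a)) ∂(copulaLaw ν) = ∫ u, f u ∂(copulaLaw ν) := by
    intro f hf
    have h := integral_map (μ := copulaLaw ν) hT.aemeasurable hf.aestronglyMeasurable
    rw [hπ'] at h
    exact h.symm
  simp only [thetaSumIdx, hC, hS]
  rw [hint (fun u => copCIdx ν i j u * copCIdx ν k l u)
      ((measurable_copCIdx i j).mul (measurable_copCIdx k l)),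
    hint (fun u => copSIdx ν i j u * copCIdx ν k l u)
      ((measurable_copSIdx i j).mul (measurable_copCIdx k l)),
    hint (fun u => copCIdx ν i j u * copSIdx ν k l u)
      ((measurable_copCIdx i j).mul (measurable_copSIdx k l)),
    hint (fun u => copSIdx ν i j u * copSIdx ν k l u)
      ((measurable_copSIdx i j).mul (measurable_copSIdx k l))]

/-- Under partial exchangeability, `θ₁ + θ₂ + θ₃ + θ₄` is constant on the classes over which the
structured estimator averages. -/
theorem thetaSum_eq_of_mem_entryClass {G : IdxPartition d} (hG : PEA ν G) {r s : Pos d}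
    {q : Pos d × Pos d} (hq : q ∈ entryClass G r s) : thetaSum ν q.1 q.2 = thetaSum ν r s := by
  obtain ⟨-, -, hb, ho⟩ := Finset.mem_filter.1 hq
  have key := fun (r s r' s' : Pos d) => eq_of_block_eq_of_overlap_eq G (pea_iff_swap_mem.1 hG)
    (thetaSumIdx ν) thetaSumIdx_swap thetaSumIdx_comm (fun π hπ => thetaSumIdx_perm hπ)
    (r := r) (s := s) (r' := r') (s' := s')
  rcases Sym2.eq_iff.1 hb with ⟨h1, h2⟩ | ⟨h1, h2⟩
  · exact key _ _ _ _ h1 h2 ho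
  · refine (key _ _ s r h1 h2 ?_).trans (thetaSumIdx_comm _ _ _ _)
    rw [ho, overlap, overlap, Finset.inter_comm]

theorem entryClass_nonempty (G : IdxPartition d) (r s : Pos d) : (entryClass G r s).Nonempty := by
  rcases le_total (toLex r.1) (toLex s.1) with h | h
  · exact ⟨(r, s), Finset.mem_filter.2 ⟨Finset.mem_univ _, h, rfl, rfl⟩⟩
  · refine ⟨(s, r), Finset.mem_filter.2 ⟨Finset.mem_univ _, h, Sym2.eq_swap, ?_⟩⟩
    simp only [overlap, Finset.inter_comm]

variable {Ω : Type*} [MeasurableSpace Ω] {μ : Measure Ω} [IsProbabilityMeasure μ]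
  {X : ℕ → Ω → Fin d → ℝ}

theorem tendsto_tauTilde (hcont : ∀ j, Continuous (margCdf ν j)) (hlaw : ∀ k, HasLaw (X k) ν μ)
    (hindep : iIndepFun X μ) (G : IdxPartition d) :
    Tendsto (fun p : ℕ × Ω => tauTilde (fun k : Fin p.1 => X k p.2) G) (inProb μ)
      (𝓝 ((Gam G).mulVec (tau ν))) :=
  ((continuous_const.matrix_mulVec continuous_id).tendsto _).comp
    (tendsto_tauHat hcont hlaw hindep)

theorem tendsto_ThetaTilde (hcont : ∀ j, Continuous (margCdf ν j)) (hlaw : ∀ k, HasLaw (X k) ν μ)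
    (hindep : iIndepFun X μ) {G : IdxPartition d} (hG : PEA ν G) (r s : Pos d) :
    Tendsto (fun p : ℕ × Ω => (p.1 : ℝ) * ThetaTilde (fun k : Fin p.1 => X k p.2) G r s)
      (inProb μ) (𝓝 (16 * thetaSum ν r s)) := by
  have hcard : ((entryClass G r s).card : ℝ) ≠ 0 := by
    exact_mod_cast (Finset.card_pos.2 (entryClass_nonempty G r s)).ne'
  have hlim := (tendsto_finsetSum (entryClass G r s) fun q _ =>
    tendsto_ThetaHat hcont hlaw hindep q.1 q.2).div_const ((entryClass G r s).card : ℝ)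
  have hval : (∑ q ∈ entryClass G r s, 16 * thetaSum ν q.1 q.2) / ((entryClass G r s).card : ℝ)
      = 16 * thetaSum ν r s := by
    rw [Finset.sum_congr rfl fun q hq => by rw [thetaSum_eq_of_mem_entryClass hG hq],
      Finset.sum_const, nsmul_eq_mul, mul_div_cancel_left₀ _ hcard]
  rw [hval] at hlim
  refine hlim.congr fun p => ?_
  rw [ThetaTilde, Matrix.of_apply, ← Finset.mul_sum, mul_div_assoc]

theorem tendsto_SigmaTilde (hcont : ∀ j, Continuous (margCdf ν j)) (hlaw : ∀ k, HasLaw (X k) ν μ)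
    (hindep : iIndepFun X μ) {G : IdxPartition d} (hG : PEA ν G)
    (hΓ : (Gam G).mulVec (tau ν) = tau ν) :
    Tendsto (fun p : ℕ × Ω => (p.1 : ℝ) • SigmaTilde (fun k : Fin p.1 => X k p.2) G)
      (inProb μ) (𝓝 (SigmaInf ν)) := by
  refine tendsto_pi_nhds.2 fun r => tendsto_pi_nhds.2 fun s => ?_
  have hτ := tendsto_pi_nhds.1 (tendsto_tauTilde hcont hlaw hindep G)
  rw [hΓ] at hτ
  have hρ := tendsto_natCast_div_sub_one.comp (tendsto_fst_inProb μ)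
  have hinv : Tendsto (fun p : ℕ × Ω => ((p.1 : ℝ))⁻¹) (inProb μ) (𝓝 0) :=
    tendsto_inv_atTop_nhds_zero_nat.comp (tendsto_fst_inProb μ)
  have hcoef := ((hinv.const_mul 6).const_sub 4).mul hρ
  have hlim := (tendsto_ThetaTilde hcont hlaw hindep hG r s).sub
    (hcoef.mul (((hτ r).add_const 1).mul ((hτ s).add_const 1)))
  have hval : 16 * thetaSum ν r s - (4 - 6 * 0) * 1 * ((tau ν r + 1) * (tau ν s + 1))
      = SigmaInf ν r s := by
    rw [SigmaInf, Matrix.of_apply]; ring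
  rw [hval] at hlim
  refine hlim.congr' ?_
  filter_upwards [(tendsto_fst_inProb μ).eventually (eventually_gt_atTop 1)] with p hp
  have h1 : (1 : ℝ) < p.1 := by exact_mod_cast hp
  have h0 : (p.1 : ℝ) ≠ 0 := by positivity
  have h2 : (p.1 : ℝ) - 1 ≠ 0 := by linarith
  simp only [SigmaTilde, Matrix.smul_apply, Matrix.sub_apply, Matrix.of_apply, smul_eq_mul,
    Function.comp_apply]
  field_simp
  ring

theorem tendsto_SigmaTildeW (hcont : ∀ j, Continuous (margCdf ν j))
    (hlaw : ∀ k, HasLaw (X k) ν μ) (hindep : iIndepFun X μ) {G : IdxPartition d} (hG : PEA ν G)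
    (hΓ : (Gam G).mulVec (tau ν) = tau ν) {w : ℕ → ℝ} (hw0 : Tendsto w atTop (𝓝 0)) :
    Tendsto (fun p : ℕ × Ω => (p.1 : ℝ) • SigmaTildeW (fun k : Fin p.1 => X k p.2) (w p.1) G)
      (inProb μ) (𝓝 (SigmaInf ν)) := by
  have hS := tendsto_SigmaTilde hcont hlaw hindep hG hΓ
  have hw := hw0.comp (tendsto_fst_inProb μ)
  have hdiag : Tendsto (fun M : Matrix (Pos d) (Pos d) ℝ => Matrix.diagonal fun r => M r r)
      (𝓝 (SigmaInf ν)) (𝓝 (Matrix.diagonal fun r => SigmaInf ν r r)) :=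
    (continuous_id.matrix_diag.matrix_diagonal).tendsto (SigmaInf ν)
  have hlim := ((hw.const_sub 1).smul hS).add (hw.smul (hdiag.comp hS))
  rw [sub_zero, one_smul, zero_smul, add_zero] at hlim
  refine hlim.congr fun p => ?_
  ext r s
  simp only [SigmaTildeW, Function.comp_apply, Matrix.add_apply, Matrix.smul_apply,
    Matrix.diagonal_apply, smul_eq_mul]
  split_ifs <;> ring

end Covariance

/-! ### The criterion in the limit and the path -/

section Path

variable {d : ℕ}

theorem loss_smul (t u : Pos d → ℝ) (S : Matrix (Pos d) (Pos d) ℝ) {c : ℝ} (hc : c ≠ 0) :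
    loss t u (c • S) = c⁻¹ * loss t u S := by
  have hinv : (c • S)⁻¹ = c⁻¹ • S⁻¹ := by
    by_cases hS : IsUnit S.det
    · exact Matrix.inv_smul' S (Units.mk0 c hc) hS
    -- a singular matrix and its multiples have inverse `0`
    · have hcS : ¬ IsUnit (c • S).det := by
        rw [Matrix.det_smul, IsUnit.mul_iff]
        exact fun h => hS h.2
      rw [Matrix.nonsing_inv_apply_not_isUnit _ hS, Matrix.nonsing_inv_apply_not_isUnit _ hcS,
        smul_zero]
  rw [loss, loss, hinv, Matrix.smul_mulVec, dotProduct_smul, smul_eq_mul]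

theorem tendsto_loss {α : Type*} {F : Filter α} {t u : α → Pos d → ℝ}
    {S : α → Matrix (Pos d) (Pos d) ℝ} {t₀ u₀ : Pos d → ℝ} {S₀ : Matrix (Pos d) (Pos d) ℝ}
    (ht : Tendsto t F (𝓝 t₀)) (hu : Tendsto u F (𝓝 u₀)) (hS : Tendsto S F (𝓝 S₀))
    (h0 : S₀.det ≠ 0) : Tendsto (fun a => loss (t a) (u a) (S a)) F (𝓝 (loss t₀ u₀ S₀)) := by
  have hinv : Tendsto (fun a => (S a)⁻¹) F (𝓝 S₀⁻¹) := by
    refine Tendsto.comp (continuousAt_matrix_inv S₀ ?_) hS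
    rw [Ring.inverse_eq_inv']
    exact continuousAt_inv₀ h0
  have hcont : Continuous fun z : (Pos d → ℝ) × Matrix (Pos d) (Pos d) ℝ =>
      dotProduct z.1 (z.2.mulVec z.1) :=
    continuous_fst.dotProduct (continuous_snd.matrix_mulVec continuous_fst)
  have hz := (hu.sub ht).prodMk_nhds hinv
  have hlim := (hcont.tendsto _).comp hz
  unfold loss
  exact hlim

variable {ν : Measure (Fin d → ℝ)} [IsProbabilityMeasure ν]
  {Ω : Type*} [MeasurableSpace Ω] {μ : Measure Ω} [IsProbabilityMeasure μ]
  {X : ℕ → Ω → Fin d → ℝ}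

/-- As long as the current partition `H` is exchangeable, the algorithm prefers any candidate `K`
that fits `τ` to any candidate `L` that does not, with probability tending to `1`: after
multiplication by `1 / n` the criterion converges to `0` for `K` and to a positive number
for `L`. -/
theorem eventually_criterion_lt (hcont : ∀ j, Continuous (margCdf ν j))
    (hlaw : ∀ k, HasLaw (X k) ν μ) (hindep : iIndepFun X μ) (hpos : (SigmaInf ν).PosDef)
    {w : ℕ → ℝ} (hw0 : Tendsto w atTop (𝓝 0)) {H K L : IdxPartition d} (hH : PEA ν H)
    (hΓH : (Gam H).mulVec (tau ν) = tau ν) (hΓK : (Gam K).mulVec (tau ν) = tau ν)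
    (hΓL : (Gam L).mulVec (tau ν) ≠ tau ν) :
    ∀ᶠ p in inProb μ, criterion (fun k : Fin p.1 => X k p.2) (w p.1) H K
      < criterion (fun k : Fin p.1 => X k p.2) (w p.1) H L := by
  have hτ := tendsto_tauHat hcont hlaw hindep
  have hS := tendsto_SigmaTildeW hcont hlaw hindep hH hΓH hw0
  have hlim := fun M : IdxPartition d =>
    tendsto_loss (tendsto_tauTilde hcont hlaw hindep M) hτ hS hpos.det_pos.ne'
  have h0 : loss ((Gam K).mulVec (tau ν)) (tau ν) (SigmaInf ν) = 0 := by
    rw [hΓK, loss, sub_self, zero_dotProduct]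
  have h1 : 0 < loss ((Gam L).mulVec (tau ν)) (tau ν) (SigmaInf ν) := by
    have := hpos.inv.dotProduct_mulVec_pos (sub_ne_zero.2 hΓL.symm)
    simpa [loss] using this
  filter_upwards [(hlim K).eventually_lt (hlim L) (by rw [h0]; exact h1),
    (tendsto_fst_inProb μ).eventually (eventually_gt_atTop 0)] with p hp hn
  have hn' : (0 : ℝ) < p.1 := by exact_mod_cast hn
  rw [loss_smul _ _ _ hn'.ne', loss_smul _ _ _ hn'.ne'] at hp
  exact lt_of_mul_lt_mul_left hp (inv_nonneg.2 hn'.le)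

/-- If refinements of `G` always beat the other candidates, the path stays below `G` until it has
as many clusters as `G`, and then equals `G`. -/
theorem IsReturnedPath.mem_of_criterion_lt (hd : 1 ≤ d) {n : ℕ} {x : Fin n → Fin d → ℝ} {w : ℝ}
    {P : Set (IdxPartition d)} (hP : IsReturnedPath x w P) {G : IdxPartition d}
    (hlt : ∀ H K L, H ≤ G → K ≤ G → ¬ L ≤ G → criterion x w H K < criterion x w H L) : G ∈ P := by
  obtain ⟨g, hgd, hstep, rfl⟩ := hP
  have hG1 : 1 ≤ G.parts.card := Finset.card_pos.2 ⟨_, part_mem_parts G ⟨0, hd⟩⟩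
  have hGd : G.parts.card ≤ d := by simpa using G.card_parts_le_card
  have hcard : ∀ i, 1 ≤ i → i ≤ d → (g i).parts.card = i := by
    intro i h1 h2
    rcases h2.eq_or_lt with rfl | h
    · rw [hgd, Finpartition.card_bot]; simp
    · exact (hstep i h1 h).1.2
  have hle : g G.parts.card ≤ G := by
    refine Nat.decreasingInduction' (P := fun i => g i ≤ G) (fun i hid hGi hi => ?_) hGd
      (by rw [hgd]; exact bot_le)
    obtain ⟨hmem, hmin⟩ := hstep i (hG1.trans hGi) hid
    obtain ⟨K, hK, hKG⟩ := exists_candidate_le hi (hcard (i + 1) (by omega) hid) hGi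
    by_contra hnot
    exact absurd (hmin K hK) (not_le.2 (hlt _ _ _ hi hKG hnot))
  exact ⟨G.parts.card, ⟨hG1, hGd⟩, eq_of_le_of_card_le hle (hcard _ hG1 hGd).le⟩

end Path

end

end KendallPath

theorem corollary1 {d : ℕ} (hd : 1 ≤ d)
    -- the law of the population vector, with continuous univariate marginals
    (ν : Measure (Fin d → ℝ)) [IsProbabilityMeasure ν]
    (hcont : ∀ j, Continuous (margCdf ν j))
    -- the random sample
    {Ω : Type*} [MeasurableSpace Ω] (μ : Measure Ω) [IsProbabilityMeasure μ]
    (X : ℕ → Ω → Fin d → ℝ) (hlaw : ∀ k, HasLaw (X k) ν μ) (hindep : iIndepFun X μ)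
    -- the assumptions
    (hpos : (SigmaInf ν).PosDef)
    (hGam : ∀ H : IdxPartition d, (Gam H).mulVec (tau ν) = tau ν ↔ PEA ν H)
    (w : ℕ → ℝ) (hw : ∀ n, w n ∈ Set.Icc (0 : ℝ) 1) (hw0 : Tendsto w atTop (𝓝 0))
    -- the coarsest partition, and the paths that the algorithm returns
    (G : IdxPartition d) (hG : IsCoarsestPEA ν G)
    (P : ℕ → Ω → Set (IdxPartition d))
    (hP : ∀ n ω, IsReturnedPath (fun k : Fin n => X k ω) (w n) (P n ω)) :
    Tendsto (fun n => μ {ω | G ∈ P n ω}) atTop (𝓝 1) := by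
  have hpea := hG.pea_iff_le
  have hgood : ∀ᶠ p in inProb μ, ∀ H K L : IdxPartition d, H ≤ G → K ≤ G → ¬ L ≤ G →
      criterion (fun k : Fin p.1 => X k p.2) (w p.1) H K
        < criterion (fun k : Fin p.1 => X k p.2) (w p.1) H L := by
    refine eventually_all.2 fun H => eventually_all.2 fun K => eventually_all.2 fun L => ?_
    simp only [eventually_imp_distrib_left]
    intro hH hK hL
    rw [← hpea] at hH hK hL
    exact eventually_criterion_lt hcont hlaw hindep hpos hw0 hH ((hGam H).2 hH) ((hGam K).2 hK)
      fun h => hL ((hGam L).1 h)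
  exact tendsto_measure_of_eventually_inProb (p := fun p => G ∈ P p.1 p.2)
    (hgood.mono fun p hp => (hP p.1 p.2).mem_of_criterion_lt hd hp)
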